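/- Let $d\ge 1$, let $A,B$ be finite sets with probability vectors $p=(p_a)_{a\in A}$ and $q=(q_b)_{b\in B}$, and let $X\sim(A^{\mathbb Z^d},\mu)$ and $Y\sim(B^{\mathbb Z^d},\nu)$ be the i.i.d. $\mathbb Z^d$-processes with $\mu=p^{\mathbb Z^d}$, $\nu=q^{\mathbb Z^d}$. Assume they have equal entropy: $-\sum_{a\in A}p_a\log p_a=-\sum_{b\in B}q_b\log q_b$ (with $0\log 0=0$). Let $\varphi:(A^{\mathbb Z^d},\mu)\to(B^{\mathbb Z^d},\nu)$ be a factor map, that is, a measurable map with $\varphi_*\mu=\nu$ that commutes $\mu$-almost everywhere with every translation of $\mathbb Z^d$. Its coding radius is $$R_\varphi(x)=\min\{n\in\mathbb N\cup\{\infty\}:\ \text{for $\mu$-a.e. }a,\ (a_i)_{i\in[-n,n]^d}=(x_i)_{i\in[-n,n]^d}\Rightarrow\varphi(a)_0=\varphi(x)_0\}.$$ Suppose that $\varphi$ is finitary, i.e. $R_\varphi<\infty$ $\mu$-a.s., and that $\mathbf E_\mu[R_\varphi^{d/2}]<\infty$. Then the information functions $I_p(a)=\log p_a^{-1}$ and $I_q(b)=\log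 q_b^{-1}$ satisfy $$\operatorname{Var}(I_p(X_0))=\operatorname{Var}(I_q(Y_0)).$$ -/

import Mathlib

open MeasureTheory ProbabilityTheory
open scoped ENNReal

noncomputable section

namespace FinitaryFactor

/-- Configurations on the lattice `ℤ^d` with symbols in `A`. -/
abbrev Config (d : ℕ) (A : Type*) : Type _ := (Fin d → ℤ) → A

/-- The translation `x ↦ (v ↦ x (v + u))` of configurations. -/
def shift {d : ℕ} {A : Type*} (u : Fin d → ℤ) (x : Config d A) : Config d A :=
  fun v => x (v + u)

/-- The law of the i.i.d. `ℤ^d`-process with marginal `p`: the product measure `p^{ℤ^d}`. -/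
def iidLaw (d : ℕ) {A : Type*} [MeasurableSpace A] (p : Measure A) : Measure (Config d A) :=
  Measure.infinitePi (fun _ : Fin d → ℤ => p)

/-- The information function `I_p(a) = log (1 / p_a)`. -/
def information {A : Type*} [MeasurableSpace A] (p : Measure A) (a : A) : ℝ :=
  Real.log (p.real {a})⁻¹

/-- The entropy `-∑ p_a log p_a` of the i.i.d. process with marginal `p`, with `0 log 0 = 0`. -/
def entropy {A : Type*} [Fintype A] [MeasurableSpace A] (p : Measure A) : ℝ :=
  -∑ a, p.real {a} * Real.log (p.real {a})

/-- A factor map (homomorphism) between shift-invariant measures: measure preserving,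
and commuting with every translation almost everywhere. -/
structure IsFactorMap {d : ℕ} {A B : Type*} [MeasurableSpace A] [MeasurableSpace B]
    (μ : Measure (Config d A)) (ν : Measure (Config d B)) (φ : Config d A → Config d B) :
    Prop where
  measurePreserving : MeasurePreserving φ μ ν
  equivariant : ∀ u : Fin d → ℤ, ∀ᵐ x ∂μ, φ (shift u x) = shift u (φ x)

/-- The cube `B(0,n) = [-n,n]^d` in `ℤ^d`. -/
def cube (d n : ℕ) : Set (Fin d → ℤ) := {i | ∀ k, |i k| ≤ (n : ℤ)}

/-- `x` restricted to `B(0,n)` determines the symbol at the origin of the image, up to null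
sets. -/
def Determines {d : ℕ} {A B : Type*} [MeasurableSpace A] (μ : Measure (Config d A))
    (φ : Config d A → Config d B) (x : Config d A) (n : ℕ) : Prop :=
  ∀ᵐ a ∂μ, (∀ i ∈ cube d n, a i = x i) → φ a 0 = φ x 0

/-- The coding radius: the least `n` such that `x` on `B(0,n)` determines `φ(x)_0`,
and `⊤` if there is none. -/
def codingRadius {d : ℕ} {A B : Type*} [MeasurableSpace A] (μ : Measure (Config d A))
    (φ : Config d A → Config d B) (x : Config d A) : ℕ∞ :=
  ⨅ (n : ℕ) (_ : Determines μ φ x n), (n : ℕ∞)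

/-- The map is finitary: its coding radius is almost surely finite. -/
def IsFinitary {d : ℕ} {A B : Type*} [MeasurableSpace A] (μ : Measure (Config d A))
    (φ : Config d A → Config d B) : Prop :=
  ∀ᵐ x ∂μ, codingRadius μ φ x < ⊤

/-- The moment `E[R_φ ^ α]` of the coding radius, as an extended nonnegative number. -/
def codingMoment {d : ℕ} {A B : Type*} [MeasurableSpace A] (μ : Measure (Config d A))
    (φ : Config d A → Config d B) (α : ℝ) : ℝ≥0∞ :=
  ∫⁻ x, (codingRadius μ φ x : ℝ≥0∞) ^ α ∂μ

end FinitaryFactor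

end

noncomputable section

namespace FinitaryFactor

open Filter Topology

/-! Let `S` and `T` be the centred information sums of source and image over a cell, a cube of
volume `r ^ 2`. Independence gives `E[S ^ 2] = r ^ 2 * σp` and `E[T ^ 2] = r ^ 2 * σq`, where `σp`,
`σq` are the two variances, so `r ^ 2 * (σp - σq) = E[(S + T) * (S - T)]`. The aim is to show that
this correlation is `o(r ^ 2)`.

The key is that `S - T` is almost uncorrelated with bounded functions of the block inside the cell.
A pattern that forces certain image symbols is at most as probable as the image pattern, hence
carries at least as much information (`sum_localInfo_le`). This holds pointwise, so it survives any
reweighting of the source. Tiling a huge box by cells and reweighting all inner blocks independently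
by the same density makes the boundary cost per cell vanish (`integral_mul_sum_nonneg`): no such
density can make `E[S - T]` negative, except through sites with coding radius above `m`. Equal
entropy gives `E[S - T] = 0`, so applying this to densities `1 ± small * ψ` bounds `|E[ψ * (S -
T)]|` by a multiple of `sup |ψ| * r ^ 2 * P(R > m)` (`abs_integral_mul_infoSum_sub_le`).

Now `S + T` is close in mean square to a function of the inner block bounded by `2 * t * r`:
restrict the sums to a smaller box, replace image symbols by the local code, and truncate at `t *
r`. After division by `r ^ 2` the error from large radii is of order `t * r * P(R > m)`. With cells
of side comparable to `m`, it vanishes because the moment of order `d / 2` yields `m ^ (d / 2) * P(R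
> m) → 0` (`tendsto_rpow_mul_radiusTail`). -/

lemma integral_comp_measurePreserving {α β : Type*} [MeasurableSpace α] [MeasurableSpace β]
    {μ : Measure α} {ν : Measure β} {f : α → β} (hf : MeasurePreserving f μ ν) {g : β → ℝ}
    (hg : AEStronglyMeasurable g ν) : ∫ x, g (f x) ∂μ = ∫ y, g y ∂ν := by
  rw [← hf.map_eq] at hg ⊢
  exact (integral_map hf.measurable.aemeasurable hg).symm

/-! ### Shift invariance and cylinder probabilities of the product measure. -/

section Basic

variable {d : ℕ} {A : Type*} [MeasurableSpace A]

instance isProbabilityMeasure_iidLaw (p : Measure A) [IsProbabilityMeasure p] :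
    IsProbabilityMeasure (iidLaw d p) := by
  unfold iidLaw; infer_instance

@[fun_prop]
lemma measurable_shift (u : Fin d → ℤ) : Measurable (shift (A := A) u) := by
  unfold shift; fun_prop

lemma shift_shift {A : Type*} (u v : Fin d → ℤ) (x : Config d A) :
    shift u (shift v x) = shift (u + v) x := by
  ext i; simp [shift, add_assoc]

lemma measurePreserving_shift (p : Measure A) [IsProbabilityMeasure p] (u : Fin d → ℤ) :
    MeasurePreserving (shift u) (iidLaw d p) (iidLaw d p) := by
  refine ⟨measurable_shift u, ?_⟩
  refine Measure.eq_infinitePi _ fun s t ht => ?_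
  rw [Measure.map_apply (measurable_shift u) (.pi s.countable_toSet fun _ _ => ht _)]
  have : shift u ⁻¹' ((s : Set (Fin d → ℤ)).pi t) =
      ((s.map (Equiv.addRight u).toEmbedding : Finset _) : Set (Fin d → ℤ)).pi
        (fun i => t (i - u)) := by
    ext x
    simp only [Set.mem_preimage, Set.mem_pi, Finset.mem_coe, Finset.mem_map_equiv]
    refine ⟨fun h i hi => ?_, fun h i hi => ?_⟩
    · have := h (i - u) (by simpa [sub_eq_add_neg] using hi)
      simpa [shift] using this
    · have := h (i + u) (by simpa using hi)
      simpa [shift] using this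
  rw [this, iidLaw, Measure.infinitePi_pi _ (fun i _ => ht _)]
  simp

lemma iidLaw_cylinder [MeasurableSingletonClass A] (p : Measure A) [IsProbabilityMeasure p]
    (s : Finset (Fin d → ℤ)) (x : Config d A) :
    (iidLaw d p).real {a | ∀ i ∈ s, a i = x i} = ∏ i ∈ s, p.real {x i} := by
  have : {a : Config d A | ∀ i ∈ s, a i = x i} = (s : Set (Fin d → ℤ)).pi fun i => {x i} := by
    ext a; simp [Set.pi]
  rw [this, measureReal_def, iidLaw, Measure.infinitePi_pi _ (fun i _ => measurableSet_singleton _),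
    ENNReal.toReal_prod]
  rfl

end Basic

/-! ### Functions of finitely many coordinates, and independence over disjoint windows. -/

section DependsOn

variable {d : ℕ} {A : Type*} [Fintype A] [MeasurableSpace A] [MeasurableSingletonClass A]

lemma exists_eq_comp_restrict {A : Type*} {f : Config d A → ℝ} {s : Finset (Fin d → ℤ)}
    (hf : DependsOn f (s : Set (Fin d → ℤ))) :
    ∃ g : (s → A) → ℝ, f = g ∘ s.restrict :=
  dependsOn_iff_exists_comp.1 hf

lemma measurable_of_dependsOn {f : Config d A → ℝ} {s : Finset (Fin d → ℤ)}
    (hf : DependsOn f (s : Set (Fin d → ℤ))) : Measurable f := by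
  obtain ⟨g, rfl⟩ := exists_eq_comp_restrict hf
  exact (measurable_of_finite g).comp (Finset.measurable_restrict s)

lemma exists_bound_of_dependsOn {A : Type*} [Finite A] {f : Config d A → ℝ} {s : Finset (Fin d → ℤ)}
    (hf : DependsOn f (s : Set (Fin d → ℤ))) : ∃ C, ∀ x, |f x| ≤ C := by
  obtain ⟨g, rfl⟩ := exists_eq_comp_restrict hf
  obtain ⟨C, hC⟩ := (Set.finite_range fun w => |g w|).bddAbove
  exact ⟨C, fun x => hC ⟨s.restrict x, rfl⟩⟩

lemma integrable_of_dependsOn (μ : Measure (Config d A)) [IsFiniteMeasure μ]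
    {f : Config d A → ℝ} {s : Finset (Fin d → ℤ)}
    (hf : DependsOn f (s : Set (Fin d → ℤ))) : Integrable f μ := by
  obtain ⟨C, hC⟩ := exists_bound_of_dependsOn hf
  exact .of_bound (measurable_of_dependsOn hf).aestronglyMeasurable C (.of_forall hC)

lemma integral_mul_of_dependsOn (p : Measure A) [IsProbabilityMeasure p]
    {f g : Config d A → ℝ} {s t : Finset (Fin d → ℤ)} (hst : Disjoint s t)
    (hf : DependsOn f (s : Set (Fin d → ℤ))) (hg : DependsOn g (t : Set (Fin d → ℤ))) :
    ∫ x, f x * g x ∂iidLaw d p = (∫ x, f x ∂iidLaw d p) * ∫ x, g x ∂iidLaw d p := by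
  have hfm := measurable_of_dependsOn hf
  have hgm := measurable_of_dependsOn hg
  obtain ⟨f', rfl⟩ := exists_eq_comp_restrict hf
  obtain ⟨g', rfl⟩ := exists_eq_comp_restrict hg
  have hind : iIndepFun (fun (i : Fin d → ℤ) (x : Config d A) => x i) (iidLaw d p) :=
    iIndepFun_infinitePi (P := fun _ : Fin d → ℤ => p) (X := fun _ a => a) (fun _ => measurable_id)
  have h := (hind.indepFun_finset s t hst (fun i => measurable_pi_apply i)).comp
    (measurable_of_finite f') (measurable_of_finite g')
  exact h.integral_fun_mul_eq_mul_integral hfm.aestronglyMeasurable hgm.aestronglyMeasurable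

lemma DependsOn.comp_shift {A β : Type*} {f : Config d A → β} {s : Finset (Fin d → ℤ)}
    (hf : DependsOn f (s : Set (Fin d → ℤ))) (u : Fin d → ℤ) :
    DependsOn (fun x => f (shift u x))
      ((s.map (Equiv.addRight u).toEmbedding : Finset _) : Set (Fin d → ℤ)) := by
  intro x y hxy
  refine hf fun i hi => hxy _ ?_
  simpa using hi

lemma DependsOn.op₂ {A β γ δ : Type*} {f : Config d A → β} {g : Config d A → γ}
    {s t : Set (Fin d → ℤ)} (op : β → γ → δ) (hf : DependsOn f s) (hg : DependsOn g t) :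
    DependsOn (fun x => op (f x) (g x)) (s ∪ t) := by
  intro x y hxy
  simp only [hf fun i hi => hxy i (Or.inl hi), hg fun i hi => hxy i (Or.inr hi)]

lemma DependsOn.finset_sum {A ι : Type*} {J : Finset ι} {f : ι → Config d A → ℝ}
    {s : Set (Fin d → ℤ)} (hf : ∀ j ∈ J, DependsOn (f j) s) :
    DependsOn (fun x => ∑ j ∈ J, f j x) s :=
  fun _ _ hxy => Finset.sum_congr rfl fun j hj => hf j hj hxy

lemma DependsOn.finset_prod {A ι : Type*} {J : Finset ι} {f : ι → Config d A → ℝ}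
    {s : ι → Set (Fin d → ℤ)} (hf : ∀ j ∈ J, DependsOn (f j) (s j)) :
    DependsOn (fun x => ∏ j ∈ J, f j x) (⋃ j ∈ J, s j) :=
  fun _ _ hxy => Finset.prod_congr rfl fun j hj => hf j hj fun i hi =>
    hxy i (Set.mem_iUnion₂.2 ⟨j, hj, hi⟩)

open scoped Classical in
/-- Mean-one factors supported on pairwise disjoint sites do not affect the integral of a function
supported on further disjoint sites. -/
lemma integral_mul_prod_of_dependsOn (p : Measure A) [IsProbabilityMeasure p] {ι : Type*}
    {J : Finset ι} {f : Config d A → ℝ} {g : ι → Config d A → ℝ} {s : Finset (Fin d → ℤ)}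
    {t : ι → Finset (Fin d → ℤ)} (hf : DependsOn f (s : Set (Fin d → ℤ)))
    (hg : ∀ j ∈ J, DependsOn (g j) (t j : Set (Fin d → ℤ)))
    (hint : ∀ j ∈ J, ∫ x, g j x ∂iidLaw d p = 1)
    (hst : ∀ j ∈ J, Disjoint s (t j))
    (ht : ∀ i ∈ J, ∀ j ∈ J, i ≠ j → Disjoint (t i) (t j)) :
    ∫ x, f x * ∏ j ∈ J, g j x ∂iidLaw d p = ∫ x, f x ∂iidLaw d p := by
  induction J using Finset.induction_on with
  | empty => simp
  | insert j J hj ih =>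
    simp only [Finset.mem_insert, forall_eq_or_imp] at hg hint hst ht
    have ih' := ih hg.2 hint.2 hst.2 (fun i hi k hk => (ht.2 i hi).2 k hk)
    have h := integral_mul_of_dependsOn p (f := fun x => f x * ∏ j ∈ J, g j x) (g := g j)
      (s := s ∪ J.biUnion t) (t := t j) ?_ ?_ hg.1
    · rw [ih', hint.1, mul_one] at h
      rw [← h]
      refine integral_congr_ae (.of_forall fun x => ?_)
      simp only [Finset.prod_insert hj]
      ring
    · rw [Finset.disjoint_union_left]
      refine ⟨hst.1, (Finset.disjoint_biUnion_left _ _ _).2 fun i hi => ?_⟩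
      exact (ht.2 i hi).1 (fun h => hj (h ▸ hi))
    · have := DependsOn.op₂ (· * ·) hf (DependsOn.finset_prod hg.2)
      simpa using this

end DependsOn

/-! ### Boxes and their volumes. -/

section Box

/-- The box `[lo, hi)^d`. -/
def box (d : ℕ) (lo hi : ℤ) : Finset (Fin d → ℤ) := Fintype.piFinset fun _ => Finset.Ico lo hi

lemma mem_box {d : ℕ} {lo hi : ℤ} {v : Fin d → ℤ} :
    v ∈ box d lo hi ↔ ∀ k, lo ≤ v k ∧ v k < hi := by
  simp [box]

lemma card_box (d : ℕ) (lo hi : ℤ) : (box d lo hi).card = (hi - lo).toNat ^ d := by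
  simp [box]

lemma card_box_real (d : ℕ) {lo hi : ℤ} (h : lo ≤ hi) :
    ((box d lo hi).card : ℝ) = ((hi : ℝ) - lo) ^ d := by
  rw [card_box]
  push_cast
  congr 1
  have : ((hi - lo).toNat : ℤ) = hi - lo := Int.toNat_of_nonneg (by linarith)
  exact_mod_cast congrArg (Int.cast (R := ℝ)) this

lemma coe_box_eq_cube (d n : ℕ) : (box d (-n) (n + 1) : Set (Fin d → ℤ)) = cube d n := by
  ext v
  simp only [Finset.mem_coe, mem_box, cube, Set.mem_ofPred_eq, abs_le, Int.lt_add_one_iff]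

lemma box_subset_box {d : ℕ} {lo hi lo' hi' : ℤ} (h : lo' ≤ lo) (h' : hi ≤ hi') :
    box d lo hi ⊆ box d lo' hi' := fun v hv => by
  rw [mem_box] at hv ⊢
  exact fun k => ⟨h.trans (hv k).1, (hv k).2.trans_le h'⟩

end Box

/-! ### Bounds and mean of the information function. -/

section Information

variable {A : Type*} [MeasurableSpace A]

lemma information_nonneg (p : Measure A) [IsProbabilityMeasure p] (a : A) :
    0 ≤ information p a := by
  unfold information
  by_cases h : p.real {a} = 0
  · simp [h]
  · exact Real.log_nonneg ((one_le_inv₀ (measureReal_nonneg.lt_of_ne' h)).2 measureReal_le_one)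

lemma exists_information_le [Finite A] (p : Measure A) [IsProbabilityMeasure p] :
    ∃ K, 0 < K ∧ ∀ a, information p a ≤ K := by
  obtain ⟨C, hC⟩ := (Set.finite_range (information p)).bddAbove
  exact ⟨max C 1, by positivity, fun a => (hC ⟨a, rfl⟩).trans (le_max_left _ _)⟩

lemma integral_information [Fintype A] [MeasurableSingletonClass A] (p : Measure A)
    [IsProbabilityMeasure p] : ∫ a, information p a ∂p = entropy p := by
  rw [integral_fintype (Integrable.of_finite)]
  simp [information, entropy]

end Information

/-! ### Radius-`m` local codes and the pointwise information inequality. -/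

section LocalCode

variable {d : ℕ} {A B : Type*} [MeasurableSpace A] [MeasurableSpace B]

/-- The pattern of `x` on `B(0,m)` forces the symbol `b` at the origin of the image. -/
def Forces (μ : Measure (Config d A)) (φ : Config d A → Config d B) (m : ℕ) (x : Config d A)
    (b : B) : Prop :=
  ∀ᵐ a ∂μ, (∀ i ∈ cube d m, a i = x i) → φ a 0 = b

open scoped Classical in
/-- The information of the symbol at the origin forced by the pattern of `x` on `B(0,m)`, and `0`
if no symbol is forced. -/
def localInfo (μ : Measure (Config d A)) (φ : Config d A → Config d B) (q : Measure B) (m : ℕ)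
    (x : Config d A) : ℝ :=
  if h : ∃ b, Forces μ φ m x b then information q h.choose else 0

/-- Equality of predicates, not mere equivalence: the symbol picked by choice in `localInfo` is then
the same for both configurations. -/
lemma forces_congr {A B : Type*} [MeasurableSpace A] {μ : Measure (Config d A)}
    {φ : Config d A → Config d B} {m : ℕ}
    {x y : Config d A} (h : ∀ i ∈ cube d m, x i = y i) : Forces μ φ m x = Forces μ φ m y := by
  funext b
  refine propext (eventually_congr (.of_forall fun a => ?_))
  rw [forall₂_congr fun i hi => by rw [h i hi]]

lemma dependsOn_localInfo (μ : Measure (Config d A)) (φ : Config d A → Config d B)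
    (q : Measure B) (m : ℕ) :
    DependsOn (localInfo μ φ q m) (box d (-m) (m + 1) : Set (Fin d → ℤ)) := by
  intro x y hxy
  rw [coe_box_eq_cube] at hxy
  unfold localInfo
  rw [forces_congr hxy]

lemma localInfo_nonneg (μ : Measure (Config d A)) (φ : Config d A → Config d B)
    (q : Measure B) [IsProbabilityMeasure q] (m : ℕ) (x : Config d A) :
    0 ≤ localInfo μ φ q m x := by
  unfold localInfo
  split_ifs
  exacts [information_nonneg q _, le_rfl]

lemma localInfo_le (μ : Measure (Config d A)) (φ : Config d A → Config d B)
    (q : Measure B) (m : ℕ) {K : ℝ} (hK0 : 0 ≤ K) (hK : ∀ b, information q b ≤ K)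
    (x : Config d A) : localInfo μ φ q m x ≤ K := by
  unfold localInfo
  split_ifs
  exacts [hK _, hK0]

open scoped Classical in
/-- The information carried by a pattern dominates the information of the symbols it forces. -/
lemma sum_localInfo_le [MeasurableSingletonClass A] [MeasurableSingletonClass B]
    (p : Measure A) [IsProbabilityMeasure p]
    (q : Measure B) [IsProbabilityMeasure q] {φ : Config d A → Config d B}
    (hφ : IsFactorMap (iidLaw d p) (iidLaw d q) φ) {m : ℕ} {s t : Finset (Fin d → ℤ)}
    (hst : ∀ v ∈ s, ∀ i ∈ cube d m, i + v ∈ t) {x : Config d A}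
    (hx : ∀ i ∈ t, p.real {x i} ≠ 0) :
    ∑ v ∈ s, localInfo (iidLaw d p) φ q m (shift v x) ≤ ∑ i ∈ t, information p (x i) := by
  set μ := iidLaw d p
  -- Unforced sites contribute the default value `0`, so only the forced ones matter.
  let s' := s.filter fun v => ∃ b, Forces μ φ m (shift v x) b
  let y : Config d B := fun v =>
    if h : ∃ b, Forces μ φ m (shift v x) b then h.choose else φ x v
  have hy : ∀ v ∈ s', Forces μ φ m (shift v x) (y v) := fun v hv => by
    have h := (Finset.mem_filter.1 hv).2
    simp only [y, dif_pos h]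
    exact h.choose_spec
  have hsum : ∑ v ∈ s, localInfo μ φ q m (shift v x) = ∑ v ∈ s', information q (y v) := by
    rw [Finset.sum_filter]
    refine Finset.sum_congr rfl fun v _ => ?_
    by_cases h : ∃ b, Forces μ φ m (shift v x) b
    · simp only [localInfo, y, dif_pos h, if_pos h]
    · simp only [localInfo, dif_neg h, if_neg h]
  have hmeas : MeasurableSet {b : Config d B | ∀ v ∈ s', b v = y v} := by
    have : {b : Config d B | ∀ v ∈ s', b v = y v} = (s' : Set (Fin d → ℤ)).pi fun v => {y v} := by
      ext a; simp [Set.pi]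
    rw [this]
    exact .pi s'.countable_toSet fun _ _ => measurableSet_singleton _
  -- Up to a null set, the cylinder of `x` over `t` lies in the preimage of the cylinder of forced
  -- symbols; comparing measures and taking logarithms gives the claim.
  have hae : ∀ᵐ a ∂μ, (∀ i ∈ t, a i = x i) → ∀ v ∈ s', φ a v = y v := by
    have h1 : ∀ᵐ a ∂μ, ∀ v ∈ s', φ (shift v a) = shift v (φ a) :=
      (Finset.eventually_all s').2 fun v _ => hφ.equivariant v
    have h2 : ∀ᵐ a ∂μ, ∀ v ∈ s', (∀ i ∈ cube d m, shift v a i = shift v x i) →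
        φ (shift v a) 0 = y v :=
      (Finset.eventually_all s').2 fun v hv =>
        (measurePreserving_shift p v).quasiMeasurePreserving.ae (hy v hv)
    filter_upwards [h1, h2] with a h1 h2 ha v hv
    have := h2 v hv fun i hi => ha _ (hst v (Finset.mem_filter.1 hv).1 i hi)
    rw [h1 v hv] at this
    simpa [shift] using this
  have hle : ∏ i ∈ t, p.real {x i} ≤ ∏ v ∈ s', q.real {y v} := by
    rw [← iidLaw_cylinder p t x, ← iidLaw_cylinder q s' y,
      ← hφ.measurePreserving.measureReal_preimage hmeas.nullMeasurableSet]
    exact ENNReal.toReal_mono (measure_ne_top _ _) (measure_mono_ae hae)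
  have hpos : 0 < ∏ i ∈ t, p.real {x i} :=
    Finset.prod_pos fun i hi => measureReal_nonneg.lt_of_ne' (hx i hi)
  have hq : ∀ v ∈ s', q.real {y v} ≠ 0 := fun v hv h => by
    rw [Finset.prod_eq_zero hv h] at hle
    exact hpos.not_ge hle
  have hlog := Real.log_le_log hpos hle
  rw [Real.log_prod hx, Real.log_prod hq] at hlog
  rw [hsum]
  simp only [information, Real.log_inv, Finset.sum_neg_distrib]
  linarith

lemma ae_measureReal_ne_zero [Countable A] [MeasurableSingletonClass A] (p : Measure A)
    [IsProbabilityMeasure p] : ∀ᵐ x ∂iidLaw d p, ∀ i, p.real {x i} ≠ 0 := by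
  refine ae_all_iff.2 fun i => ?_
  have h : ∀ᵐ a ∂p, p.real {a} ≠ 0 := by
    rw [ae_iff_of_countable]
    intro a ha
    exact ENNReal.toReal_ne_zero.2 ⟨ha, measure_ne_top _ _⟩
  exact (measurePreserving_eval_infinitePi (fun _ : Fin d → ℤ => p) i).quasiMeasurePreserving.ae h

/-- The local code is correct off the event that the coding radius exceeds `m`. -/
lemma ae_abs_localInfo_sub_le [Fintype A] [MeasurableSingletonClass A]
    (p : Measure A) [IsProbabilityMeasure p] (q : Measure B) [IsProbabilityMeasure q]
    (φ : Config d A → Config d B) (m : ℕ) {K : ℝ} (hK : ∀ b, information q b ≤ K) :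
    ∀ᵐ x ∂iidLaw d p, |localInfo (iidLaw d p) φ q m x - information q (φ x 0)| ≤
      {x | ¬ Determines (iidLaw d p) φ x m}.indicator (fun _ => K) x := by
  filter_upwards [ae_measureReal_ne_zero p] with x hx
  have hK0 : 0 ≤ K := (information_nonneg q _).trans (hK (φ x 0))
  by_cases hdet : Determines (iidLaw d p) φ x m
  · have h : ∃ b, Forces (iidLaw d p) φ m x b := ⟨_, hdet⟩
    have hpos : 0 < (iidLaw d p).real {a | ∀ i ∈ box d (-m) (m + 1), a i = x i} := by
      rw [iidLaw_cylinder]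
      exact Finset.prod_pos fun i _ => measureReal_nonneg.lt_of_ne' (hx i)
    -- A null pattern would force every symbol. The pattern of a typical `x` has positive
    -- probability, so its forced symbol is unique.
    have heq : h.choose = φ x 0 := by
      by_contra hne
      refine hpos.ne' ?_
      rw [measureReal_def, ENNReal.toReal_eq_zero_iff]
      left
      rw [measure_eq_zero_iff_ae_notMem]
      filter_upwards [h.choose_spec, hdet] with a h1 h2 ha
      have ha' : ∀ i ∈ cube d m, a i = x i := by
        rw [← coe_box_eq_cube]; exact ha
      exact hne ((h1 ha').symm.trans (h2 ha'))
    have : localInfo (iidLaw d p) φ q m x = information q (φ x 0) := by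
      unfold localInfo
      rw [dif_pos h, heq]
    simp [this, hdet]
  · rw [Set.indicator_of_mem (by exact hdet), abs_le]
    have h1 := localInfo_nonneg (iidLaw d p) φ q m x
    have h2 := localInfo_le (iidLaw d p) φ q m hK0 hK x
    have h3 := information_nonneg q (φ x 0)
    have h4 := hK (φ x 0)
    constructor <;> linarith

end LocalCode

/-! ### Tilings by cells and independent reweighting of the inner blocks. -/

section Tiling

variable {d : ℕ}

lemma eq_of_add_smul_eq {P : ℤ} {u v j k : Fin d → ℤ} (h : u + P • j = v + P • k)
    (huv : ∀ l, |u l - v l| < P) : j = k := by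
  funext l
  have h1 := congrFun h l
  simp only [Pi.add_apply, Pi.smul_apply, smul_eq_mul] at h1
  have h2 : P ∣ u l - v l := ⟨k l - j l, by linarith⟩
  have h3 := Int.eq_zero_of_abs_lt_dvd h2 (huv l)
  have hP : P ≠ 0 := fun h => absurd (huv l) (by simp [h])
  have h4 : P * (j l - k l) = 0 := by linarith
  rcases mul_eq_zero.1 h4 with h | h
  · exact absurd h hP
  · linarith

lemma tendsto_boundary_ratio (d : ℕ) (P b : ℝ) :
    Tendsto (fun M : ℕ => (P + b / (M : ℝ)) ^ d - P ^ d) atTop (𝓝 0) := by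
  have h : Tendsto (fun M : ℕ => (P + b / (M : ℝ)) ^ d - P ^ d) atTop
      (𝓝 ((P + 0) ^ d - P ^ d)) :=
    (((tendsto_const_div_atTop_nhds_zero_nat b).const_add P).pow d).sub_const _
  simpa using h

variable {A : Type*} [Fintype A] [MeasurableSpace A] [MeasurableSingletonClass A]

/-- The weight that reweights independently every block `P j + [0,a)^d`. -/
def blockWeight (L : Config d A → ℝ) (P : ℤ) (M : ℕ) (x : Config d A) : ℝ :=
  ∏ j ∈ box d 0 M, L (shift (P • j) x)

variable {f L : Config d A → ℝ} {m a : ℕ}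

open scoped Classical in
-- After translation to the cell at the origin, the integrand reads coordinates in `[-2m, a + 2m)`.
-- The period `a + 2m` is just large enough to keep every other block outside this window, so the
-- other weights integrate out to `1`.
lemma integral_blockWeight_mul (p : Measure A) [IsProbabilityMeasure p]
    (hf : DependsOn f (box d (-m) (m + 1) : Set (Fin d → ℤ)))
    (hL : DependsOn L (box d 0 a : Set (Fin d → ℤ))) (hL1 : ∫ x, L x ∂iidLaw d p = 1)
    (M : ℕ) {j v : Fin d → ℤ} (hj : j ∈ box d 0 M)
    (hv : v ∈ box d (-m) (a + m)) :
    ∫ x, f (shift (v + ((a : ℤ) + 2 * m) • j) x) * blockWeight L ((a : ℤ) + 2 * m) M x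
        ∂iidLaw d p = ∫ x, f (shift v x) * L x ∂iidLaw d p := by
  set P : ℤ := (a : ℤ) + 2 * m with hP
  have hshift : ∀ j, ∫ x, L (shift (P • j) x) ∂iidLaw d p = 1 := fun j => by
    rw [← hL1]
    exact integral_comp_measurePreserving (measurePreserving_shift p (P • j))
      (measurable_of_dependsOn hL).aestronglyMeasurable
  have hfL : DependsOn (fun x => f (shift v x) * L x)
      (((box d (-m) (m + 1)).map (Equiv.addRight v).toEmbedding ∪ box d 0 a : Finset _) :
        Set (Fin d → ℤ)) := by
    rw [Finset.coe_union]
    exact DependsOn.op₂ (· * ·) (DependsOn.comp_shift hf v) hL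
  have hmem : ∀ i ∈ (box d (-m) (m + 1)).map (Equiv.addRight v).toEmbedding ∪ box d 0 a,
      ∀ l, -2 * (m : ℤ) ≤ i l ∧ i l < a + 2 * m := by
    intro i hi l
    rcases Finset.mem_union.1 hi with h | h
    · obtain ⟨i', hi', rfl⟩ := Finset.mem_map.1 h
      have h1 := mem_box.1 hi' l
      have h2 := mem_box.1 hv l
      simp only [Equiv.coe_toEmbedding, Equiv.coe_addRight, Pi.add_apply]
      constructor <;> linarith
    · have h1 := mem_box.1 h l
      constructor <;> linarith
  have key := integral_mul_prod_of_dependsOn p (J := (box d 0 M).erase j)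
    (DependsOn.comp_shift hfL (P • j))
    (g := fun j x => L (shift (P • j) x)) (fun j _ => DependsOn.comp_shift hL (P • j))
    (fun j _ => hshift j) ?_ ?_
  · rw [← integral_comp_measurePreserving (measurePreserving_shift p (P • j))
      (measurable_of_dependsOn hfL).aestronglyMeasurable, ← key]
    refine integral_congr_ae (.of_forall fun x => ?_)
    simp only [blockWeight, shift_shift]
    rw [← Finset.mul_prod_erase _ _ hj]
    ring
  · intro k hk
    rw [Finset.disjoint_left]
    intro i hi hi'
    obtain ⟨u, hu, rfl⟩ := Finset.mem_map.1 hi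
    obtain ⟨w, hw, hwu⟩ := Finset.mem_map.1 hi'
    simp only [Equiv.coe_toEmbedding, Equiv.coe_addRight] at hwu
    refine Finset.ne_of_mem_erase hk (eq_of_add_smul_eq hwu fun l => ?_)
    have h1 := hmem u hu l
    have h2 := mem_box.1 hw l
    rw [abs_lt]
    constructor <;> linarith
  · intro k hk k' hk' hne
    rw [Finset.disjoint_left]
    intro i hi hi'
    obtain ⟨u, hu, rfl⟩ := Finset.mem_map.1 hi
    obtain ⟨w, hw, hwu⟩ := Finset.mem_map.1 hi'
    simp only [Equiv.coe_toEmbedding, Equiv.coe_addRight] at hwu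
    refine hne (eq_of_add_smul_eq hwu fun l => ?_).symm
    have h1 := mem_box.1 hu l
    have h2 := mem_box.1 hw l
    rw [abs_lt]
    constructor <;> linarith

lemma integral_blockWeight (p : Measure A) [IsProbabilityMeasure p] (ha : 0 < a)
    (hL : DependsOn L (box d 0 a : Set (Fin d → ℤ))) (hL1 : ∫ x, L x ∂iidLaw d p = 1)
    (M : ℕ) :
    ∫ x, blockWeight L ((a : ℤ) + 2 * m) M x ∂iidLaw d p = 1 := by
  rcases (box d 0 (M : ℤ)).eq_empty_or_nonempty with h | ⟨j, hj⟩
  · simp [blockWeight, h]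
  have hv : (0 : Fin d → ℤ) ∈ box d (-m) (a + m) := mem_box.2 fun l => by
    simp only [Pi.zero_apply]; omega
  have := integral_blockWeight_mul p (f := fun _ => (1 : ℝ)) (m := m)
    (fun _ _ _ => rfl) hL hL1 M hj hv
  simpa [hL1] using this

/-- If the sums of a local function over large finite sets are bounded below by boundary terms, then
its sum over a cell has nonnegative mean under every reweighting of the inner block. -/
lemma integral_mul_sum_nonneg (p : Measure A) [IsProbabilityMeasure p]
    (ha : 0 < a) (hf : DependsOn f (box d (-m) (m + 1) : Set (Fin d → ℤ)))
    (hL : DependsOn L (box d 0 a : Set (Fin d → ℤ))) (hL1 : ∫ x, L x ∂iidLaw d p = 1)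
    (hL0 : ∀ x, 0 ≤ L x) {C : ℝ}
    (H : ∀ s t : Finset (Fin d → ℤ), s ⊆ t → (∀ v ∈ s, ∀ i ∈ cube d m, i + v ∈ t) →
      ∀ᵐ x ∂iidLaw d p, -C * ((t.card : ℝ) - s.card) ≤ ∑ v ∈ s, f (shift v x)) :
    0 ≤ ∫ x, (∑ v ∈ box d (-m) (a + m), f (shift v x)) * L x ∂iidLaw d p := by
  classical
  set μ := iidLaw d p
  set P : ℤ := (a : ℤ) + 2 * m with hP
  set X := ∫ x, (∑ v ∈ box d (-m) (a + m), f (shift v x)) * L x ∂μ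
  -- Average the lower bound over `M ^ d` cells and divide by their number: what remains is a
  -- surface-to-volume ratio.
  have hbound : ∀ M : ℕ, 0 < M →
      -C * (((P : ℝ) + (2 * m : ℝ) / (M : ℝ)) ^ d - (P : ℝ) ^ d) ≤ X := by
    intro M hM
    let cell := box d (-m) ((a : ℤ) + m)
    let e : (Fin d → ℤ) × (Fin d → ℤ) → (Fin d → ℤ) := fun jv => jv.2 + P • jv.1
    let s := (box d 0 M ×ˢ cell).image e
    -- The cells fill `[-m, M * P - m)^d`; `t` is this box enlarged by `m` on each side.
    let t := box d (-(2 * m)) (M * P)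
    have hinj : Set.InjOn e (box d 0 M ×ˢ cell : Finset _) := by
      rintro ⟨j, v⟩ hjv ⟨k, w⟩ hkw h
      have hjk : j = k := by
        refine eq_of_add_smul_eq h fun l => ?_
        have h1 := mem_box.1 (Finset.mem_product.1 hjv).2 l
        have h2 := mem_box.1 (Finset.mem_product.1 hkw).2 l
        rw [abs_lt]
        constructor <;> linarith
      subst hjk
      exact Prod.ext rfl (add_right_cancel h)
    have hst : ∀ v ∈ s, ∀ i ∈ cube d m, i + v ∈ t := by
      intro u hu i hi
      obtain ⟨⟨j, v⟩, hjv, rfl⟩ := Finset.mem_image.1 hu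
      rw [Finset.mem_product] at hjv
      refine mem_box.2 fun l => ?_
      have h1 : 0 ≤ j l ∧ j l < M := mem_box.1 hjv.1 l
      have h2 := mem_box.1 hjv.2 l
      have h3 := abs_le.1 (hi l)
      have hP0 : 0 ≤ P := by positivity
      have h4 : 0 ≤ P * j l := mul_nonneg hP0 h1.1
      have h5 : P * j l ≤ P * (M - 1) := mul_le_mul_of_nonneg_left (by omega) hP0
      simp only [e, Pi.add_apply, Pi.smul_apply, smul_eq_mul]
      constructor <;> linarith
    have hsub : s ⊆ t := fun v hv => by
      simpa using hst v hv 0 (by simp [cube])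
    have hcs : (s.card : ℝ) = (M : ℝ) ^ d * (P : ℝ) ^ d := by
      rw [Finset.card_image_of_injOn hinj, Finset.card_product]
      push_cast
      rw [card_box_real d (by positivity), card_box_real d (by linarith)]
      push_cast
      rw [hP]
      push_cast
      ring
    have hct : (t.card : ℝ) = ((M : ℝ) * P + 2 * m) ^ d := by
      rw [card_box_real d (by have : 0 ≤ (M : ℤ) * P := by positivity
                              linarith)]
      push_cast
      ring
    have hw : DependsOn (blockWeight L P M)
        (((box d 0 M).biUnion fun j => (box d 0 a).map (Equiv.addRight (P • j)).toEmbedding :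
          Finset _) : Set (Fin d → ℤ)) := by
      rw [Finset.coe_biUnion]
      exact DependsOn.finset_prod fun j _ => DependsOn.comp_shift hL (P • j)
    have hw0 : ∀ x, 0 ≤ blockWeight L P M x := fun x => Finset.prod_nonneg fun _ _ => hL0 _
    have hint : ∀ u, Integrable (fun x => f (shift u x) * blockWeight L P M x) μ := fun u => by
      have := DependsOn.op₂ (· * ·) (DependsOn.comp_shift hf u) hw
      rw [← Finset.coe_union] at this
      exact integrable_of_dependsOn μ this
    have hint' : ∀ v, Integrable (fun x => f (shift v x) * L x) μ := fun v => by
      have := DependsOn.op₂ (· * ·) (DependsOn.comp_shift hf v) hL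
      rw [← Finset.coe_union] at this
      exact integrable_of_dependsOn μ this
    have hX : X = ∑ v ∈ cell, ∫ x, f (shift v x) * L x ∂μ := by
      rw [← integral_finsetSum _ fun v _ => hint' v]
      simp only [X, Finset.sum_mul, cell]
    have hsum : ∫ x, (∑ v ∈ s, f (shift v x)) * blockWeight L P M x ∂μ = (M : ℝ) ^ d * X := by
      simp only [Finset.sum_mul]
      rw [integral_finsetSum _ fun v _ => hint v, Finset.sum_image hinj, Finset.sum_product]
      have : ∀ j ∈ box d 0 M, ∑ v ∈ cell,
          ∫ x, f (shift (e (j, v)) x) * blockWeight L P M x ∂μ = X := fun j hj => by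
        rw [hX]
        exact Finset.sum_congr rfl fun v hv => integral_blockWeight_mul p hf hL hL1 M hj hv
      rw [Finset.sum_congr rfl this, Finset.sum_const, nsmul_eq_mul,
        card_box_real d (by positivity)]
      push_cast
      rw [sub_zero]
    have hlow : -C * ((t.card : ℝ) - s.card) ≤
        ∫ x, (∑ v ∈ s, f (shift v x)) * blockWeight L P M x ∂μ := by
      have h1 : ∫ x, (-C * ((t.card : ℝ) - s.card)) * blockWeight L P M x ∂μ =
          -C * ((t.card : ℝ) - s.card) := by
        rw [integral_const_mul, integral_blockWeight p ha hL hL1 M, mul_one]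
      rw [← h1]
      refine integral_mono_ae ((integrable_of_dependsOn μ hw).const_mul _) ?_ ?_
      · simp only [Finset.sum_mul]
        exact integrable_finsetSum _ fun v _ => hint v
      · filter_upwards [H s t hsub hst] with x hx
        exact mul_le_mul_of_nonneg_right hx (hw0 x)
    rw [hsum, hcs, hct] at hlow
    have hMd : (0 : ℝ) < (M : ℝ) ^ d := by positivity
    have hexp : (M : ℝ) ^ d * (((P : ℝ) + (2 * m : ℝ) / (M : ℝ)) ^ d - (P : ℝ) ^ d) =
        ((M : ℝ) * P + 2 * m) ^ d - (M : ℝ) ^ d * (P : ℝ) ^ d := by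
      rw [mul_sub, ← mul_pow]
      congr 2
      field_simp
    refine le_of_mul_le_mul_left ?_ hMd
    calc _ = -C * ((M : ℝ) ^ d * (((P : ℝ) + (2 * m : ℝ) / (M : ℝ)) ^ d - (P : ℝ) ^ d)) := by ring
      _ ≤ _ := by rw [hexp]; exact hlow
  have hlim := (tendsto_boundary_ratio d (P : ℝ) (2 * m)).const_mul (-C)
  rw [mul_zero] at hlim
  exact le_of_tendsto hlim ((eventually_gt_atTop 0).mono fun M hM => hbound M hM)

end Tiling

/-! ### Decorrelation of `S - T` from bounded functions of the inner block. -/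

section Correlation

variable {d : ℕ} {A B : Type*} [Fintype A] [MeasurableSpace A] [MeasurableSingletonClass A]
  [Fintype B] [MeasurableSpace B] [MeasurableSingletonClass B]

/-- The centred information of the pattern of `x` on `s`. -/
def infoSum (p : Measure A) (s : Finset (Fin d → ℤ)) (x : Config d A) : ℝ :=
  ∑ v ∈ s, (information p (x v) - entropy p)

lemma dependsOn_infoSum {A : Type*} [Fintype A] [MeasurableSpace A] (p : Measure A) (s : Finset (Fin d → ℤ)) :
    DependsOn (infoSum p s) (s : Set (Fin d → ℤ)) :=
  DependsOn.finset_sum fun v hv x y hxy => by simp only [hxy v hv]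

lemma measurable_infoSum (p : Measure A) (s : Finset (Fin d → ℤ)) : Measurable (infoSum p s) :=
  measurable_of_dependsOn (dependsOn_infoSum p s)

lemma integral_comp_eval (p : Measure A) [IsProbabilityMeasure p] (f : A → ℝ) (v : Fin d → ℤ) :
    ∫ x, f (x v) ∂iidLaw d p = ∫ a, f a ∂p :=
  integral_comp_measurePreserving (measurePreserving_eval_infinitePi (fun _ : Fin d → ℤ => p) v)
    (measurable_of_finite f).aestronglyMeasurable

lemma integral_infoSum (p : Measure A) [IsProbabilityMeasure p] (s : Finset (Fin d → ℤ)) :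
    ∫ x, infoSum p s x ∂iidLaw d p = 0 := by
  unfold infoSum
  rw [integral_finsetSum]
  · refine Finset.sum_eq_zero fun v _ => ?_
    rw [integral_comp_eval p (fun a => information p a - entropy p),
      integral_sub .of_finite .of_finite, integral_information]
    simp
  · intro v _
    exact integrable_of_dependsOn (s := {v}) _ fun x y h => by simp only [h v (by simp)]

/-- The event depends only on the pattern of `x` on the cube and on `φ x 0`, a pair with finitely
many values. -/
lemma measurableSet_determines (μ : Measure (Config d A)) {φ : Config d A → Config d B}
    (hφ : Measurable φ) (m : ℕ) : MeasurableSet {x | Determines μ φ x m} := by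
  let π : Config d A → (box d (-m) (m + 1) → A) × B := fun x => (Finset.restrict _ x, φ x 0)
  have hπ : Measurable π :=
    (Finset.measurable_restrict _).prodMk ((measurable_pi_apply 0).comp hφ)
  have : {x | Determines μ φ x m} = π ⁻¹' (π '' {x | Determines μ φ x m}) := by
    refine (Set.subset_preimage_image _ _).antisymm ?_
    rintro x ⟨y, hy, hyx⟩
    have h1 : ∀ i ∈ cube d m, y i = x i := fun i hi => by
      rw [← coe_box_eq_cube] at hi
      exact congrFun (congrArg Prod.fst hyx) ⟨i, hi⟩
    have h2 : φ y 0 = φ x 0 := congrArg Prod.snd hyx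
    change ∀ᵐ a ∂μ, _ at hy
    change ∀ᵐ a ∂μ, _
    filter_upwards [hy] with a ha hax
    rw [← h2]
    exact ha fun i hi => (hax i hi).trans (h1 i hi).symm
  rw [this]
  exact hπ (Set.toFinite _).measurableSet

/-- The probability that the coding radius exceeds `m`. -/
def radiusTail (μ : Measure (Config d A)) (φ : Config d A → Config d B) (m : ℕ) : ℝ :=
  μ.real {x | ¬ Determines μ φ x m}

variable (p : Measure A) [IsProbabilityMeasure p] (q : Measure B) [IsProbabilityMeasure q]
  {φ : Config d A → Config d B}

lemma integrable_localInfo_sub (hφ : IsFactorMap (iidLaw d p) (iidLaw d q) φ) (m : ℕ)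
    (v : Fin d → ℤ) :
    Integrable (fun x => localInfo (iidLaw d p) φ q m (shift v x) - information q (φ x v))
      (iidLaw d p) := by
  refine .sub (integrable_of_dependsOn _ (DependsOn.comp_shift (dependsOn_localInfo _ φ q m) v)) ?_
  exact hφ.measurePreserving.integrable_comp_of_integrable
    (g := fun y : Config d B => information q (y v))
    (integrable_of_dependsOn (s := {v}) _ fun x y h => by simp only [h v (by simp)])

/-- Equivariance and stationarity carry the error at the origin to any site; an error is at most `K`
and occurs only where radius `m` is insufficient. -/
lemma integral_abs_localInfo_sub_le (hφ : IsFactorMap (iidLaw d p) (iidLaw d q) φ) (m : ℕ)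
    {K : ℝ} (hK : ∀ b, information q b ≤ K) (v : Fin d → ℤ) :
    ∫ x, |localInfo (iidLaw d p) φ q m (shift v x) - information q (φ x v)| ∂iidLaw d p ≤
      K * radiusTail (iidLaw d p) φ m := by
  have hmeas : MeasurableSet {x | ¬ Determines (iidLaw d p) φ x m} :=
    (measurableSet_determines _ hφ.measurePreserving.measurable m).compl
  have hI : Integrable ({x | ¬ Determines (iidLaw d p) φ x m}.indicator fun _ => K)
      (iidLaw d p) := (integrable_const K).indicator hmeas
  have hshift := measurePreserving_shift p v
  have h1 : K * radiusTail (iidLaw d p) φ m =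
      ∫ x, {x | ¬ Determines (iidLaw d p) φ x m}.indicator (fun _ => K) (shift v x)
        ∂iidLaw d p := by
    have : ∫ x, {x | ¬ Determines (iidLaw d p) φ x m}.indicator (fun _ => K) x ∂iidLaw d p =
        K * radiusTail (iidLaw d p) φ m := by
      rw [integral_indicator_const _ hmeas, smul_eq_mul, mul_comm]; rfl
    rw [← this, integral_comp_measurePreserving hshift hI.aestronglyMeasurable]
  rw [h1]
  refine integral_mono_ae (integrable_localInfo_sub p q hφ m v).abs
    (hshift.integrable_comp_of_integrable hI) ?_
  filter_upwards [hφ.equivariant v, hshift.quasiMeasurePreserving.ae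
    (ae_abs_localInfo_sub_le p q φ m hK)] with x hx h
  have : φ (shift v x) 0 = φ x v := by rw [hx]; simp [shift]
  rwa [this] at h

lemma integrable_infoSum_sub (hφ : IsFactorMap (iidLaw d p) (iidLaw d q) φ)
    (s : Finset (Fin d → ℤ)) :
    Integrable (fun x => infoSum p s x - infoSum q s (φ x)) (iidLaw d p) :=
  (integrable_of_dependsOn _ (dependsOn_infoSum p s)).sub
    (hφ.measurePreserving.integrable_comp_of_integrable
      (integrable_of_dependsOn _ (dependsOn_infoSum q s)))

/-- A bounded reweighting of the inner block cannot make the image carry more information than the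
source, up to the sites with large coding radius. -/
lemma integral_weight_mul_infoSum_sub_ge (hent : entropy p = entropy q)
    (hφ : IsFactorMap (iidLaw d p) (iidLaw d q) φ) {m a : ℕ} (ha : 0 < a)
    {K : ℝ} (hK : ∀ b, information q b ≤ K) {L : Config d A → ℝ}
    (hL : DependsOn L (box d 0 a : Set (Fin d → ℤ))) (hL1 : ∫ x, L x ∂iidLaw d p = 1)
    (hL0 : ∀ x, 0 ≤ L x) (hL2 : ∀ x, L x ≤ 2) :
    -(2 * K * (box d (-m) (a + m)).card * radiusTail (iidLaw d p) φ m) ≤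
      ∫ x, L x * (infoSum p (box d (-m) (a + m)) x - infoSum q (box d (-m) (a + m)) (φ x))
        ∂iidLaw d p := by
  classical
  set μ := iidLaw d p
  set cell := box d (-m) ((a : ℤ) + m)
  let g := localInfo μ φ q m
  -- Replacing the image information by its local version makes the difference a function of
  -- finitely many coordinates. Over `s` its sum can be negative only through the information of the
  -- sites in `t \ s`, at most `C` each.
  let f : Config d A → ℝ := fun x => information p (x 0) - g x
  have hf : DependsOn f (box d (-m) (m + 1) : Set (Fin d → ℤ)) := by
    intro x y hxy
    have h0 : x 0 = y 0 := hxy 0 (mem_box.2 fun l => by simp only [Pi.zero_apply]; omega)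
    simp only [f, h0, g, dependsOn_localInfo μ φ q m hxy]
  obtain ⟨C, hC0, hC⟩ := exists_information_le p
  have hf_shift : ∀ v x, f (shift v x) = information p (x v) - g (shift v x) := fun v x => by
    simp [f, shift]
  have hpos := integral_mul_sum_nonneg p ha hf hL hL1 hL0 (C := C) fun s t hst hcube => by
    filter_upwards [ae_measureReal_ne_zero p] with x hx
    have h1 := sum_localInfo_le p q hφ hcube (x := x) fun i _ => hx i
    have h2 : ∑ i ∈ t \ s, information p (x i) ≤ C * ((t.card : ℝ) - s.card) := by
      calc _ ≤ ∑ i ∈ t \ s, C := Finset.sum_le_sum fun i _ => hC _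
        _ = _ := by
          rw [Finset.sum_const, nsmul_eq_mul, Finset.card_sdiff_of_subset hst,
            Nat.cast_sub (Finset.card_le_card hst)]
          ring
    have h3 := Finset.sum_sdiff (f := fun i => information p (x i)) hst
    simp only [hf_shift, Finset.sum_sub_distrib]
    simp only [g]
    linarith
  let G : Config d A → ℝ := fun x => ∑ v ∈ cell, |g (shift v x) - information q (φ x v)|
  have hGi : Integrable G μ :=
    integrable_finsetSum _ fun v _ => (integrable_localInfo_sub p q hφ m v).abs
  have hG : ∫ x, G x ∂μ ≤ cell.card * (K * radiusTail μ φ m) := by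
    rw [integral_finsetSum _ fun v _ => (integrable_localInfo_sub p q hφ m v).abs, ← nsmul_eq_mul,
      ← Finset.sum_const]
    exact Finset.sum_le_sum fun v _ => integral_abs_localInfo_sub_le p q hφ m hK v
  have hLbdd : ∀ x, ‖L x‖ ≤ 2 := fun x => by
    rw [Real.norm_eq_abs, abs_of_nonneg (hL0 x)]; exact hL2 x
  have hLm := (measurable_of_dependsOn hL).aestronglyMeasurable (μ := μ)
  have hfi : Integrable (fun x => (∑ v ∈ cell, f (shift v x)) * L x) μ :=
    (integrable_finsetSum _ fun v _ =>
      integrable_of_dependsOn μ (DependsOn.comp_shift hf v)).mul_bdd hLm (.of_forall hLbdd)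
  -- Returning from the local code to the true image costs `2 * G`, as the weight is at most `2`.
  -- Equal entropy cancels the centring constants.
  have hmain : ∫ x, ((∑ v ∈ cell, f (shift v x)) * L x - 2 * G x) ∂μ ≤
      ∫ x, L x * (infoSum p cell x - infoSum q cell (φ x)) ∂μ := by
    refine integral_mono (hfi.sub (hGi.const_mul 2))
      ((integrable_infoSum_sub p q hφ cell).bdd_mul hLm (.of_forall hLbdd)) fun x => ?_
    have h1 : infoSum p cell x - infoSum q cell (φ x) =
        ∑ v ∈ cell, f (shift v x) + ∑ v ∈ cell, (g (shift v x) - information q (φ x v)) := by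
      simp only [infoSum, ← Finset.sum_sub_distrib, ← Finset.sum_add_distrib, hf_shift, hent]
      exact Finset.sum_congr rfl fun v _ => by ring
    have h2 : -G x ≤ ∑ v ∈ cell, (g (shift v x) - information q (φ x v)) := by
      rw [← Finset.sum_neg_distrib]
      exact Finset.sum_le_sum fun v _ => neg_abs_le _
    have hGx : 0 ≤ G x := Finset.sum_nonneg fun _ _ => abs_nonneg _
    simp only [h1]
    nlinarith [hL0 x, hL2 x, mul_le_mul_of_nonneg_left h2 (hL0 x),
      mul_le_mul_of_nonneg_right (hL2 x) hGx]
  rw [integral_sub hfi (hGi.const_mul 2), integral_const_mul] at hmain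
  linarith

/-- The difference of the informations of source and image is nearly uncorrelated with bounded
functions of the inner block. -/
lemma abs_integral_mul_infoSum_sub_le (hent : entropy p = entropy q)
    (hφ : IsFactorMap (iidLaw d p) (iidLaw d q) φ) {m a : ℕ} (ha : 0 < a)
    {K : ℝ} (hK : ∀ b, information q b ≤ K) {ψ : Config d A → ℝ}
    (hψ : DependsOn ψ (box d 0 a : Set (Fin d → ℤ))) {M : ℝ} (hM : 0 < M)
    (hψM : ∀ x, |ψ x| ≤ M) :
    |∫ x, ψ x * (infoSum p (box d (-m) (a + m)) x - infoSum q (box d (-m) (a + m)) (φ x))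
        ∂iidLaw d p| ≤
      4 * M * K * (box d (-m) (a + m)).card * radiusTail (iidLaw d p) φ m := by
  set μ := iidLaw d p
  set cell := box d (-m) ((a : ℤ) + m)
  set D : Config d A → ℝ := fun x => infoSum p cell x - infoSum q cell (φ x) with hD
  have hDi : Integrable D μ := integrable_infoSum_sub p q hφ cell
  have hD0 : ∫ x, D x ∂μ = 0 := by
    have h1 : Integrable (fun x => infoSum q cell (φ x)) μ :=
      hφ.measurePreserving.integrable_comp_of_integrable
        (integrable_of_dependsOn (iidLaw d q) (dependsOn_infoSum q cell))
    rw [integral_sub (integrable_of_dependsOn _ (dependsOn_infoSum p cell)) h1, integral_infoSum,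
      integral_comp_measurePreserving hφ.measurePreserving
        (measurable_infoSum q cell).aestronglyMeasurable, integral_infoSum, sub_zero]
  have key : ∀ χ : Config d A → ℝ, DependsOn χ (box d 0 a : Set (Fin d → ℤ)) →
      (∀ x, |χ x| ≤ M) → -(4 * M * K * cell.card * radiusTail μ φ m) ≤ ∫ x, χ x * D x ∂μ := by
    intro χ hχ hχM
    have hχi := integrable_of_dependsOn μ hχ
    set c := ∫ x, χ x ∂μ with hc
    have hcM : |c| ≤ M := by
      have := norm_integral_le_of_norm_le_const (μ := μ) (f := χ) (C := M) (.of_forall hχM)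
      simpa using this
    have h1 : ∀ x, |(χ x - c) / (2 * M)| ≤ 1 := fun x => by
      rw [abs_div, abs_of_pos (by positivity : 0 < 2 * M), div_le_one (by positivity)]
      calc _ ≤ |χ x| + |c| := abs_sub _ _
        _ ≤ _ := by linarith [hχM x]
    -- Since `|χ - c| ≤ 2 * M`, this is a probability density with values in `[0, 2]`; its constant
    -- part contributes nothing because `D` has mean zero.
    have hL := integral_weight_mul_infoSum_sub_ge p q hent hφ ha (m := m) hK
      (L := fun x => 1 + (χ x - c) / (2 * M))
      (fun x y hxy => by simp only [hχ hxy]) ?_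
      (fun x => by have := neg_le_of_abs_le (h1 x); linarith)
      (fun x => by have := le_of_abs_le (h1 x); linarith)
    · have hχD : Integrable (fun x => χ x * D x) μ :=
        hDi.bdd_mul hχi.aestronglyMeasurable (.of_forall hχM)
      have h2 : ∫ x, (1 + (χ x - c) / (2 * M)) * D x ∂μ = (∫ x, χ x * D x ∂μ) / (2 * M) := by
        have : ∀ x, (1 + (χ x - c) / (2 * M)) * D x =
            (1 - c / (2 * M)) * D x + (χ x * D x) / (2 * M) := fun x => by ring
        simp only [this]
        rw [integral_add (hDi.const_mul _) (hχD.div_const _), integral_const_mul, hD0, mul_zero,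
          zero_add, integral_div]
      have hL' := hL.trans_eq h2
      rw [le_div_iff₀ (by positivity)] at hL'
      linarith
    · have h2 : Integrable (fun x => χ x - c) μ := hχi.sub (integrable_const _)
      rw [integral_add (integrable_const _) (h2.div_const _),
        integral_div, integral_sub hχi (integrable_const _)]
      simp [μ, ← hc]
  rw [abs_le]
  refine ⟨key ψ hψ hψM, ?_⟩
  -- The one-sided bound for the opposite function gives the other side.
  have := key (fun x => -ψ x) (fun x y hxy => by simp only [hψ hxy]) (fun x => by simpa using hψM x)
  simp only [neg_mul, integral_neg] at this
  linarith

end Correlation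

/-! ### Truncation estimates. -/

section Clip

/-- Truncation of a real number to `[-r, r]`. -/
def clip (r w : ℝ) : ℝ := max (-r) (min w r)

lemma abs_clip_le {r : ℝ} (hr : 0 ≤ r) (w : ℝ) : |clip r w| ≤ r :=
  abs_le.2 ⟨le_max_left _ _, max_le (by linarith) (min_le_right _ _)⟩

lemma abs_clip_sub_clip_le (r u w : ℝ) : |clip r u - clip r w| ≤ |u - w| :=
  calc |clip r u - clip r w| ≤ max |-r - -r| |min u r - min w r| :=
        abs_max_sub_max_le_max _ _ _ _
    _ = |min u r - min w r| := by simp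
    _ ≤ max |u - w| |r - r| := abs_min_sub_min_le_max _ _ _ _
    _ = |u - w| := by simp

/-- Turns a first-moment bound into a mean-square one. Local-code errors at different sites may be
strongly correlated, so only their first moments add up usefully. -/
lemma sq_clip_sub_clip_le {r : ℝ} (hr : 0 ≤ r) (u w : ℝ) :
    (clip r u - clip r w) ^ 2 ≤ 2 * r * |u - w| := by
  rw [← sq_abs, sq]
  refine mul_le_mul ?_ (abs_clip_sub_clip_le r u w) (abs_nonneg _) (by positivity)
  calc _ ≤ |clip r u| + |clip r w| := abs_sub _ _
    _ ≤ _ := by linarith [abs_clip_le hr u, abs_clip_le hr w]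

/-- From `z ^ 2 ≤ 2 * exp z` for `z ≥ 0`, applied to the rescaled excess over the truncation level;
the two exponentials serve the two tails. -/
lemma sq_sub_clip_le {r t : ℝ} (hr : 0 < r) (ht : 0 ≤ t) (w : ℝ) :
    (w - clip (t * r) w) ^ 2 ≤
      2 * r ^ 2 * Real.exp (-t) * (Real.exp (r⁻¹ * w) + Real.exp (-r⁻¹ * w)) := by
  have hM : 0 ≤ t * r := by positivity
  have key : ∀ z, 0 ≤ z - t * r →
      (z - t * r) ^ 2 ≤ 2 * r ^ 2 * Real.exp (-t) * Real.exp (r⁻¹ * z) := by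
    intro z hz
    have h1 : z - t * r = r * (r⁻¹ * z - t) := by field_simp
    have h2 : 0 ≤ r⁻¹ * z - t := by
      rw [h1] at hz; exact nonneg_of_mul_nonneg_right hz hr
    have h3 := Real.quadratic_le_exp_of_nonneg h2
    have h4 : Real.exp (-t) * Real.exp (r⁻¹ * z) = Real.exp (r⁻¹ * z - t) := by
      rw [← Real.exp_add]; ring_nf
    rw [h1, mul_pow, mul_assoc (2 * r ^ 2), h4]
    nlinarith [sq_nonneg r]
  have hpos : 0 ≤ 2 * r ^ 2 * Real.exp (-t) := by positivity
  rcases le_or_gt w (t * r) with h | h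
  · rcases le_or_gt (-(t * r)) w with h' | h'
    · have : clip (t * r) w = w := by rw [clip, min_eq_left h, max_eq_right h']
      rw [this, sub_self, zero_pow two_ne_zero]
      positivity
    · have : clip (t * r) w = -(t * r) := by rw [clip, min_eq_left h, max_eq_left h'.le]
      have h1 := key (-w) (by linarith)
      have h2 : r⁻¹ * -w = -r⁻¹ * w := by ring
      rw [h2] at h1
      rw [this]
      nlinarith [mul_nonneg hpos (Real.exp_pos (r⁻¹ * w)).le]
  · have : clip (t * r) w = t * r := by rw [clip, min_eq_right h.le, max_eq_right (by linarith)]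
    have h1 := key w (by linarith)
    rw [this]
    nlinarith [mul_nonneg hpos (Real.exp_pos (-r⁻¹ * w)).le]

end Clip

/-! ### Second moments and sub-Gaussian tails of information sums. -/

section Moments

variable {d : ℕ} {A : Type*} [Fintype A] [MeasurableSpace A] [MeasurableSingletonClass A]
  (p : Measure A) [IsProbabilityMeasure p]

lemma iIndepFun_information :
    iIndepFun (fun (v : Fin d → ℤ) (x : Config d A) => information p (x v) - entropy p)
      (iidLaw d p) :=
  iIndepFun_infinitePi (P := fun _ : Fin d → ℤ => p)
    (X := fun _ a => information p a - entropy p) (fun _ => measurable_of_finite _)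

lemma integral_sq_infoSum (s : Finset (Fin d → ℤ)) :
    ∫ x, infoSum p s x ^ 2 ∂iidLaw d p =
      s.card * variance (fun x => information p (x 0)) (iidLaw d p) := by
  have hmeas : ∀ v : Fin d → ℤ, Measurable fun x : Config d A => information p (x v) := fun v =>
    (measurable_of_finite (information p)).comp (measurable_pi_apply v)
  have hvar : ∀ v : Fin d → ℤ,
      variance (fun x : Config d A => information p (x v) - entropy p) (iidLaw d p) =
        variance (fun x => information p (x 0)) (iidLaw d p) := by
    intro v
    rw [variance_sub_const (hmeas v).aestronglyMeasurable,
      variance_eq_integral (hmeas v).aemeasurable, variance_eq_integral (hmeas 0).aemeasurable]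
    simp only [integral_comp_eval p (information p)]
    rw [integral_comp_eval p fun a => (information p a - ∫ a, information p a ∂p) ^ 2,
      integral_comp_eval p fun a => (information p a - ∫ a, information p a ∂p) ^ 2]
  rw [← variance_of_integral_eq_zero (measurable_infoSum p s).aemeasurable (integral_infoSum p s)]
  have h1 : infoSum (d := d) p s = ∑ v ∈ s, fun x => information p (x v) - entropy p := by
    ext x; simp [infoSum]
  rw [h1, IndepFun.variance_sum]
  · rw [Finset.sum_congr rfl fun v _ => hvar v, Finset.sum_const, nsmul_eq_mul]
  · intro v _
    obtain ⟨C, -, hC⟩ := exists_information_le p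
    refine MemLp.sub (MemLp.of_bound (hmeas v).aestronglyMeasurable C (.of_forall fun x => ?_))
      (memLp_const _)
    rw [Real.norm_eq_abs, abs_of_nonneg (information_nonneg p _)]
    exact hC _
  · exact fun v _ w _ hvw => (iIndepFun_information p).indepFun hvw

lemma integral_sq_infoSum_sub {s t : Finset (Fin d → ℤ)} (hst : s ⊆ t) :
    ∫ x, (infoSum p t x - infoSum p s x) ^ 2 ∂iidLaw d p =
      ((t.card : ℝ) - s.card) * variance (fun x => information p (x 0)) (iidLaw d p) := by
  classical
  have h : ∀ x : Config d A, infoSum p t x - infoSum p s x = infoSum p (t \ s) x := fun x => by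
    unfold infoSum
    rw [← Finset.sum_sdiff hst]
    ring
  simp only [h]
  rw [integral_sq_infoSum, Finset.card_sdiff_of_subset hst, Nat.cast_sub (Finset.card_le_card hst)]

/-- Truncating an information sum at `t` standard units costs little in mean square. -/
lemma exists_integral_sq_infoSum_sub_clip_le :
    ∃ C, 0 ≤ C ∧ ∀ (s : Finset (Fin d → ℤ)) (r t : ℝ), 0 < r → 0 ≤ t → (s.card : ℝ) ≤ r ^ 2 →
      ∫ x, (infoSum p s x - clip (t * r) (infoSum p s x)) ^ 2 ∂iidLaw d p ≤
        C * Real.exp (-t) * r ^ 2 := by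
  obtain ⟨K, -, hK⟩ := exists_information_le p
  have hsub : ∀ v : Fin d → ℤ,
      HasSubgaussianMGF (fun x : Config d A => information p (x v) - entropy p)
        ((‖K - 0‖₊ / 2) ^ 2) (iidLaw d p) := fun v => by
    have h := hasSubgaussianMGF_of_mem_Icc (μ := iidLaw d p) (a := 0) (b := K)
      (X := fun x : Config d A => information p (x v))
      ((measurable_of_finite (information p)).comp (measurable_pi_apply v)).aemeasurable
      (.of_forall fun x => ⟨information_nonneg p _, hK _⟩)
    simpa only [integral_comp_eval p (information p), integral_information] using h
  set c := (‖K - 0‖₊ / 2) ^ 2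
  refine ⟨4 * Real.exp (c / 2), by positivity, fun s r t hr ht hs => ?_⟩
  have hsum := HasSubgaussianMGF.sum_of_iIndepFun (iIndepFun_information p) (s := s)
    (fun v _ => hsub v)
  change HasSubgaussianMGF (infoSum p s) _ _ at hsum
  -- At `u = ±1 / r` the sub-Gaussian bound is independent of scale, because `s` has at most `r ^ 2`
  -- sites.
  have hmgf : ∀ u : ℝ, u ^ 2 = (r ^ 2)⁻¹ →
      ∫ x, Real.exp (u * infoSum p s x) ∂iidLaw d p ≤ Real.exp (c / 2) := fun u hu => by
    refine (hsum.mgf_le u).trans (Real.exp_le_exp.2 ?_)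
    rw [hu]
    simp only [Finset.sum_const, nsmul_eq_mul, NNReal.coe_mul, NNReal.coe_natCast]
    have h1 : (s.card : ℝ) * (r ^ 2)⁻¹ ≤ 1 := by
      rw [← div_eq_mul_inv, div_le_one (by positivity)]; exact hs
    have hc : (0 : ℝ) ≤ c := c.coe_nonneg
    nlinarith
  have hi : ∀ u : ℝ, Integrable (fun x => Real.exp (u * infoSum p s x)) (iidLaw d p) :=
    hsum.integrable_exp_mul
  calc _ ≤ ∫ x, 2 * r ^ 2 * Real.exp (-t) * (Real.exp (r⁻¹ * infoSum p s x) +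
        Real.exp (-r⁻¹ * infoSum p s x)) ∂iidLaw d p := by
        refine integral_mono ?_ (((hi _).add (hi _)).const_mul _)
          fun x => sq_sub_clip_le hr ht _
        exact integrable_of_dependsOn (s := s) _ fun x y hxy => by
          simp only [dependsOn_infoSum p s hxy]
    _ ≤ 2 * r ^ 2 * Real.exp (-t) * (Real.exp (c / 2) + Real.exp (c / 2)) := by
        rw [integral_const_mul, integral_add (hi _) (hi _)]
        refine mul_le_mul_of_nonneg_left (add_le_add ?_ ?_) (by positivity)
        · exact hmgf _ (by rw [inv_pow])
        · exact hmgf _ (by rw [neg_sq, inv_pow])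
    _ = _ := by ring

end Moments

/-! ### Tail of the coding radius from its moment. -/

section Radius

variable {d : ℕ} {A B : Type*} [Fintype A] [MeasurableSpace A] [MeasurableSingletonClass A]
  [Fintype B] [MeasurableSpace B] [MeasurableSingletonClass B]

lemma Determines.mono {A B : Type*} [MeasurableSpace A] {μ : Measure (Config d A)}
    {φ : Config d A → Config d B}
    {x : Config d A} {m n : ℕ} (hmn : m ≤ n) (h : Determines μ φ x m) : Determines μ φ x n := by
  unfold Determines at h ⊢
  filter_upwards [h] with a ha hax
  exact ha fun i hi => hax i fun k => (hi k).trans (by exact_mod_cast hmn)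

lemma le_codingRadius {A B : Type*} [MeasurableSpace A] {μ : Measure (Config d A)}
    {φ : Config d A → Config d B} {x : Config d A} {m : ℕ} (h : ¬ Determines μ φ x m) :
    (m : ℕ∞) ≤ codingRadius μ φ x :=
  le_iInf₂ fun n hn => by
    by_contra hlt
    exact h (hn.mono (by exact_mod_cast (not_le.1 hlt).le))

/-- Markov's inequality on the tail event alone: the integral of `R ^ α` over these events, which
decrease to a null set, tends to `0`. This gains little-o over the usual bound. -/
lemma tendsto_rpow_mul_radiusTail {μ : Measure (Config d A)} [IsProbabilityMeasure μ]
    {φ : Config d A → Config d B} (hφ : Measurable φ) (hfin : IsFinitary μ φ) {α : ℝ}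
    (hα : 0 ≤ α) (hmom : codingMoment μ φ α < ⊤) :
    Tendsto (fun m : ℕ => (m : ℝ) ^ α * radiusTail μ φ m) atTop (𝓝 0) := by
  let s : ℕ → Set (Config d A) := fun m => {x | ¬ Determines μ φ x m}
  have hs : ∀ m, MeasurableSet (s m) := fun m => (measurableSet_determines μ hφ m).compl
  have hanti : Antitone s := fun m n hmn x hx h => hx (h.mono hmn)
  have hzero : μ (⋂ m, s m) = 0 := by
    rw [measure_eq_zero_iff_ae_notMem]
    filter_upwards [hfin] with x hx hmem
    rw [Set.mem_iInter] at hmem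
    refine hx.ne ?_
    unfold codingRadius
    simp only [iInf_eq_top]
    exact fun n hn => absurd hn (hmem n)
  have hlim : Tendsto (fun m => μ (s m)) atTop (𝓝 0) := by
    rw [← hzero]
    exact tendsto_measure_iInter_atTop (fun m => (hs m).nullMeasurableSet) hanti
      ⟨0, measure_ne_top _ _⟩
  have hint := tendsto_setLIntegral_zero (μ := μ)
    (f := fun x => ((codingRadius μ φ x : ℕ∞) : ℝ≥0∞) ^ α) hmom.ne hlim
  have hle : ∀ m : ℕ, ENNReal.ofReal ((m : ℝ) ^ α * radiusTail μ φ m) ≤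
      ∫⁻ x in s m, ((codingRadius μ φ x : ℕ∞) : ℝ≥0∞) ^ α ∂μ := fun m => by
    calc _ = ∫⁻ _ in s m, ((m : ℝ≥0∞)) ^ α ∂μ := by
          rw [setLIntegral_const, ENNReal.ofReal_mul (by positivity), radiusTail,
            ofReal_measureReal, ← ENNReal.ofReal_rpow_of_nonneg (by positivity) hα,
            ENNReal.ofReal_natCast]
      _ ≤ _ := by
          refine setLIntegral_mono' (hs m) fun x hx => ENNReal.rpow_le_rpow ?_ hα
          have := le_codingRadius hx
          calc (m : ℝ≥0∞) = ((m : ℕ∞) : ℝ≥0∞) := by simp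
            _ ≤ _ := by exact_mod_cast this
  have h0 : Tendsto (fun m : ℕ => ENNReal.ofReal ((m : ℝ) ^ α * radiusTail μ φ m)) atTop (𝓝 0) :=
    tendsto_of_tendsto_of_tendsto_of_le_of_le tendsto_const_nhds hint (fun _ => zero_le) hle
  have h1 := (ENNReal.tendsto_toReal ENNReal.zero_ne_top).comp h0
  refine h1.congr fun m => ?_
  simp only [Function.comp]
  exact ENNReal.toReal_ofReal (mul_nonneg (by positivity) measureReal_nonneg)

end Radius

/-! ### Bounded measurable functions, for integrability. -/

section BoundedMeasurable

variable {α : Type*} [MeasurableSpace α] {f g : α → ℝ}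

/-- Bounded measurable real functions. -/
def IsBddMeasurable (f : α → ℝ) : Prop := Measurable f ∧ ∃ C, ∀ x, |f x| ≤ C

lemma IsBddMeasurable.integrable (hf : IsBddMeasurable f) (μ : Measure α) [IsFiniteMeasure μ] :
    Integrable f μ := by
  obtain ⟨hm, C, hC⟩ := hf
  exact .of_bound hm.aestronglyMeasurable C (.of_forall hC)

lemma IsBddMeasurable.add (hf : IsBddMeasurable f) (hg : IsBddMeasurable g) :
    IsBddMeasurable fun x => f x + g x := by
  obtain ⟨hm, C, hC⟩ := hf
  obtain ⟨hm', C', hC'⟩ := hg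
  exact ⟨hm.add hm', C + C', fun x => (abs_add_le _ _).trans (add_le_add (hC x) (hC' x))⟩

lemma IsBddMeasurable.sub (hf : IsBddMeasurable f) (hg : IsBddMeasurable g) :
    IsBddMeasurable fun x => f x - g x := by
  obtain ⟨hm, C, hC⟩ := hf
  obtain ⟨hm', C', hC'⟩ := hg
  exact ⟨hm.sub hm', C + C', fun x => (abs_sub _ _).trans (add_le_add (hC x) (hC' x))⟩

lemma IsBddMeasurable.mul (hf : IsBddMeasurable f) (hg : IsBddMeasurable g) :
    IsBddMeasurable fun x => f x * g x := by
  obtain ⟨hm, C, hC⟩ := hf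
  obtain ⟨hm', C', hC'⟩ := hg
  refine ⟨hm.mul hm', C * C', fun x => ?_⟩
  rw [abs_mul]
  exact mul_le_mul (hC x) (hC' x) (abs_nonneg _) ((abs_nonneg _).trans (hC x))

lemma IsBddMeasurable.sq (hf : IsBddMeasurable f) : IsBddMeasurable fun x => f x ^ 2 := by
  simpa only [pow_two] using hf.mul hf

lemma IsBddMeasurable.abs (hf : IsBddMeasurable f) : IsBddMeasurable fun x => |f x| := by
  obtain ⟨hm, C, hC⟩ := hf
  exact ⟨hm.abs, C, fun x => (abs_abs _).trans_le (hC x)⟩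

lemma IsBddMeasurable.clip (hf : Measurable f) {r : ℝ} (hr : 0 ≤ r) :
    IsBddMeasurable fun x => clip r (f x) :=
  ⟨measurable_const.max (hf.min measurable_const), r, fun _ => abs_clip_le hr _⟩

lemma isBddMeasurable_of_dependsOn {d : ℕ} {A : Type*} [Fintype A] [MeasurableSpace A]
    [MeasurableSingletonClass A] {f : Config d A → ℝ} {s : Finset (Fin d → ℤ)}
    (hf : DependsOn f (s : Set (Fin d → ℤ))) : IsBddMeasurable f :=
  ⟨measurable_of_dependsOn hf, exists_bound_of_dependsOn hf⟩

lemma IsBddMeasurable.comp {β : Type*} [MeasurableSpace β] {φ : β → α} (hf : IsBddMeasurable f)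
    (hφ : Measurable φ) : IsBddMeasurable fun x => f (φ x) :=
  ⟨hf.1.comp hφ, hf.2.imp fun _ h _ => h _⟩

end BoundedMeasurable

/-! ### Comparison of the variances at a fixed scale. -/

section Main

variable {d : ℕ} {A B : Type*} [Fintype A] [MeasurableSpace A] [MeasurableSingletonClass A]
  [Fintype B] [MeasurableSpace B] [MeasurableSingletonClass B]
  (p : Measure A) [IsProbabilityMeasure p] (q : Measure B) [IsProbabilityMeasure q]
  {φ : Config d A → Config d B}

/-- The centred information of the symbols on `s` that are forced by radius-`m` patterns. -/
def localInfoSum {A B : Type*} [MeasurableSpace A] [Fintype B] [MeasurableSpace B]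
    (μ : Measure (Config d A)) (φ : Config d A → Config d B) (q : Measure B) (m : ℕ)
    (s : Finset (Fin d → ℤ)) (x : Config d A) : ℝ :=
  ∑ v ∈ s, (localInfo μ φ q m (shift v x) - entropy q)

lemma dependsOn_localInfoSum {A B : Type*} [MeasurableSpace A] [Fintype B] [MeasurableSpace B]
    (μ : Measure (Config d A)) (φ : Config d A → Config d B)
    (q : Measure B) (m a : ℕ) :
    DependsOn (localInfoSum μ φ q m (box d m (a - m))) (box d 0 a : Set (Fin d → ℤ)) := by
  refine DependsOn.finset_sum fun v hv x y hxy => ?_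
  have : localInfo μ φ q m (shift v x) = localInfo μ φ q m (shift v y) := by
    refine dependsOn_localInfo μ φ q m fun i hi => hxy _ (mem_box.2 fun l => ?_)
    have h1 := mem_box.1 hi l
    have h2 := mem_box.1 hv l
    simp only [Pi.add_apply]
    constructor <;> linarith
  rw [this]

lemma integral_abs_infoSum_sub_localInfoSum_le (hφ : IsFactorMap (iidLaw d p) (iidLaw d q) φ)
    (m : ℕ) {K : ℝ} (hK : ∀ b, information q b ≤ K) (s : Finset (Fin d → ℤ)) :
    ∫ x, |infoSum q s (φ x) - localInfoSum (iidLaw d p) φ q m s x| ∂iidLaw d p ≤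
      s.card * (K * radiusTail (iidLaw d p) φ m) := by
  have hint := fun v => (integrable_localInfo_sub p q hφ m v).abs
  calc _ ≤ ∫ x, ∑ v ∈ s, |localInfo (iidLaw d p) φ q m (shift v x) - information q (φ x v)|
        ∂iidLaw d p := by
        refine integral_mono_of_nonneg (.of_forall fun x => abs_nonneg _)
          (integrable_finsetSum _ fun v _ => hint v) (.of_forall fun x => ?_)
        simp only [infoSum, localInfoSum, ← Finset.sum_sub_distrib]
        refine (Finset.abs_sum_le_sum_abs _ _).trans (Finset.sum_le_sum fun v _ => ?_)
        rw [abs_sub_comm]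
        exact le_of_eq (congrArg _ (by ring))
    _ ≤ _ := by
        rw [integral_finsetSum _ fun v _ => hint v, ← nsmul_eq_mul, ← Finset.sum_const]
        exact Finset.sum_le_sum fun v _ => integral_abs_localInfo_sub_le p q hφ m hK v

/-- The mean-square distance of an information sum to a truncation of the sum over a subset. -/
lemma integral_sq_infoSum_sub_clip_le {C : ℝ}
    (hC : ∀ (s : Finset (Fin d → ℤ)) (r t : ℝ), 0 < r → 0 ≤ t → (s.card : ℝ) ≤ r ^ 2 →
      ∫ x, (infoSum p s x - clip (t * r) (infoSum p s x)) ^ 2 ∂iidLaw d p ≤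
        C * Real.exp (-t) * r ^ 2)
    {s u : Finset (Fin d → ℤ)} (hsu : s ⊆ u) {r t : ℝ} (hr : 0 < r) (ht : 0 ≤ t)
    (hs : (s.card : ℝ) ≤ r ^ 2) :
    ∫ x, (infoSum p u x - clip (t * r) (infoSum p s x)) ^ 2 ∂iidLaw d p ≤
      2 * (((u.card : ℝ) - s.card) * variance (fun x => information p (x 0)) (iidLaw d p)) +
        2 * (C * Real.exp (-t) * r ^ 2) := by
  have hu := isBddMeasurable_of_dependsOn (dependsOn_infoSum p u)
  have hs' := isBddMeasurable_of_dependsOn (dependsOn_infoSum p s)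
  have hc : IsBddMeasurable fun x => clip (t * r) (infoSum p s x) := .clip hs'.1 (by positivity)
  have i1 := ((hu.sub hs').sq.integrable (iidLaw d p)).const_mul 2
  have i2 := ((hs'.sub hc).sq.integrable (iidLaw d p)).const_mul 2
  calc _ ≤ ∫ x, (2 * (infoSum p u x - infoSum p s x) ^ 2 +
        2 * (infoSum p s x - clip (t * r) (infoSum p s x)) ^ 2) ∂iidLaw d p := by
        refine integral_mono ((hu.sub hc).sq.integrable _) (i1.add i2) fun x => ?_
        nlinarith [sq_nonneg ((infoSum p u x - infoSum p s x) -
          (infoSum p s x - clip (t * r) (infoSum p s x)))]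
    _ ≤ _ := by
        rw [integral_add i1 i2, integral_const_mul, integral_const_mul, integral_sq_infoSum_sub p hsu]
        linarith [hC s r t hr ht hs]

/-- Quantitative comparison of the information variances at a fixed scale. -/
lemma abs_variance_sub_le (hent : entropy p = entropy q)
    (hφ : IsFactorMap (iidLaw d p) (iidLaw d q) φ) {K : ℝ} (hK0 : 0 < K)
    (hK : ∀ b, information q b ≤ K) {Cp Cq : ℝ}
    (hCp : ∀ (s : Finset (Fin d → ℤ)) (r t : ℝ), 0 < r → 0 ≤ t → (s.card : ℝ) ≤ r ^ 2 →
      ∫ x, (infoSum p s x - clip (t * r) (infoSum p s x)) ^ 2 ∂iidLaw d p ≤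
        Cp * Real.exp (-t) * r ^ 2)
    (hCq : ∀ (s : Finset (Fin d → ℤ)) (r t : ℝ), 0 < r → 0 ≤ t → (s.card : ℝ) ≤ r ^ 2 →
      ∫ x, (infoSum q s x - clip (t * r) (infoSum q s x)) ^ 2 ∂iidLaw d q ≤
        Cq * Real.exp (-t) * r ^ 2)
    {m a : ℕ} (ha : 0 < a) {r t η : ℝ} (hr : 0 < r) (ht : 0 < t) (hη : 0 < η)
    (hV : ((box d (-m) (a + m)).card : ℝ) = r ^ 2) :
    |variance (fun x => information p (x 0)) (iidLaw d p) -
        variance (fun y => information q (y 0)) (iidLaw d q)| ≤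
      η⁻¹ * ((2 * variance (fun x => information p (x 0)) (iidLaw d p) +
            4 * variance (fun y => information q (y 0)) (iidLaw d q)) *
              (1 - (box d m (a - m)).card / r ^ 2) +
          (2 * Cp + 4 * Cq) * Real.exp (-t) + 4 * t * K * (r * radiusTail (iidLaw d p) φ m)) +
        η * (variance (fun x => information p (x 0)) (iidLaw d p) +
          variance (fun y => information q (y 0)) (iidLaw d q)) +
        8 * t * K * (r * radiusTail (iidLaw d p) φ m) := by
  set μ := iidLaw d p
  set cell := box d (-m) ((a : ℤ) + m)
  set inner := box d m ((a : ℤ) - m)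
  set σp := variance (fun x => information p (x 0)) μ
  set σq := variance (fun y => information q (y 0)) (iidLaw d q)
  set e := radiusTail μ φ m
  have he : 0 ≤ e := measureReal_nonneg
  have hsub : inner ⊆ cell := box_subset_box (by omega) (by omega)
  have hcard : (inner.card : ℝ) ≤ r ^ 2 := by
    rw [← hV]; exact_mod_cast Finset.card_le_card hsub
  have hmp := hφ.measurePreserving
  have htr : 0 < t * r := by positivity
  let S : Config d A → ℝ := infoSum p cell
  let T : Config d A → ℝ := fun x => infoSum q cell (φ x)
  let T' : Config d A → ℝ := fun x => infoSum q inner (φ x)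
  -- Both truncations are functions of `[0, a)^d`: sites of `inner` are at distance at least `m`
  -- from its boundary, so the local code there reads only this block.
  let ψS : Config d A → ℝ := fun x => clip (t * r) (infoSum p inner x)
  let ψT : Config d A → ℝ := fun x => clip (t * r) (localInfoSum μ φ q m inner x)
  have hS : IsBddMeasurable S := isBddMeasurable_of_dependsOn (dependsOn_infoSum p cell)
  have hT : IsBddMeasurable T :=
    (isBddMeasurable_of_dependsOn (dependsOn_infoSum q cell)).comp hmp.measurable
  have hT' : IsBddMeasurable T' :=
    (isBddMeasurable_of_dependsOn (dependsOn_infoSum q inner)).comp hmp.measurable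
  have hψS : IsBddMeasurable ψS := .clip (measurable_infoSum p inner) htr.le
  have hlocal := isBddMeasurable_of_dependsOn (dependsOn_localInfoSum μ φ q m a)
  have hψT : IsBddMeasurable ψT := .clip hlocal.1 htr.le
  have hcT' : IsBddMeasurable fun x => clip (t * r) (T' x) := .clip hT'.1 htr.le
  have hS2 : ∫ x, S x ^ 2 ∂μ = r ^ 2 * σp := by rw [← hV]; exact integral_sq_infoSum p cell
  have hT2 : ∫ x, T x ^ 2 ∂μ = r ^ 2 * σq := by
    rw [← hV, ← integral_sq_infoSum q cell]
    exact integral_comp_measurePreserving hmp (g := fun y => infoSum q cell y ^ 2)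
      ((measurable_infoSum q cell).pow_const 2).aestronglyMeasurable
  have hSψ : ∫ x, (S x - ψS x) ^ 2 ∂μ ≤
      2 * ((r ^ 2 - inner.card) * σp) + 2 * (Cp * Real.exp (-t) * r ^ 2) := by
    exact (integral_sq_infoSum_sub_clip_le p hCp hsub hr ht.le hcard).trans_eq (by rw [hV])
  have hTc : ∫ x, (T x - clip (t * r) (T' x)) ^ 2 ∂μ ≤
      2 * ((r ^ 2 - inner.card) * σq) + 2 * (Cq * Real.exp (-t) * r ^ 2) := by
    refine le_trans (le_of_eq ?_)
      ((integral_sq_infoSum_sub_clip_le q hCq hsub hr ht.le hcard).trans_eq (by rw [hV]))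
    exact integral_comp_measurePreserving hmp
      (g := fun y => (infoSum q cell y - clip (t * r) (infoSum q inner y)) ^ 2)
      (((measurable_infoSum q cell).sub (IsBddMeasurable.clip (measurable_infoSum q inner)
        htr.le).1).pow_const 2).aestronglyMeasurable
  have hTψ : ∫ x, (clip (t * r) (T' x) - ψT x) ^ 2 ∂μ ≤ 2 * (t * r) * (r ^ 2 * (K * e)) := by
    calc _ ≤ ∫ x, 2 * (t * r) * |T' x - localInfoSum μ φ q m inner x| ∂μ :=
          integral_mono ((hcT'.sub hψT).sq.integrable μ)
            (((hT'.sub hlocal).abs.integrable μ).const_mul _)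
            fun x => sq_clip_sub_clip_le htr.le _ _
      _ ≤ _ := by
          rw [integral_const_mul]
          refine mul_le_mul_of_nonneg_left ?_ (by positivity)
          exact (integral_abs_infoSum_sub_localInfoSum_le p q hφ m hK inner).trans
            (mul_le_mul_of_nonneg_right hcard (by positivity))
  -- `U` is the part of `S + T` not captured by the bounded block function `ψS + ψT`.
  let U : Config d A → ℝ := fun x => (S x - ψS x) + (T x - ψT x)
  let D : Config d A → ℝ := fun x => S x - T x
  have hU : IsBddMeasurable U := (hS.sub hψS).add (hT.sub hψT)
  have hD : IsBddMeasurable D := hS.sub hT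
  have hψ : IsBddMeasurable fun x => ψS x + ψT x := hψS.add hψT
  have hD2 : ∫ x, D x ^ 2 ∂μ ≤ 2 * (r ^ 2 * σp) + 2 * (r ^ 2 * σq) := by
    have i1 := (hS.sq.integrable μ).const_mul 2
    have i2 := (hT.sq.integrable μ).const_mul 2
    calc _ ≤ ∫ x, (2 * S x ^ 2 + 2 * T x ^ 2) ∂μ :=
          integral_mono (hD.sq.integrable μ) (i1.add i2) fun x => by
            nlinarith [sq_nonneg (S x + T x)]
      _ = _ := by rw [integral_add i1 i2, integral_const_mul, integral_const_mul, hS2, hT2]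
  have hU2 : ∫ x, U x ^ 2 ∂μ ≤
      2 * (2 * ((r ^ 2 - inner.card) * σp) + 2 * (Cp * Real.exp (-t) * r ^ 2)) +
      4 * (2 * ((r ^ 2 - inner.card) * σq) + 2 * (Cq * Real.exp (-t) * r ^ 2)) +
      4 * (2 * (t * r) * (r ^ 2 * (K * e))) := by
    have i1 := ((hS.sub hψS).sq.integrable μ).const_mul 2
    have i2 := ((hT.sub hcT').sq.integrable μ).const_mul 4
    have i12 : Integrable
        (fun x => 2 * (S x - ψS x) ^ 2 + 4 * (T x - clip (t * r) (T' x)) ^ 2) μ := i1.add i2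
    have i3 := ((hcT'.sub hψT).sq.integrable μ).const_mul 4
    calc _ ≤ ∫ x, (2 * (S x - ψS x) ^ 2 + 4 * (T x - clip (t * r) (T' x)) ^ 2 +
          4 * (clip (t * r) (T' x) - ψT x) ^ 2) ∂μ :=
          integral_mono (hU.sq.integrable μ) (i12.add i3) fun x => by
            simp only [U]
            nlinarith [sq_nonneg ((S x - ψS x) - (T x - ψT x)),
              sq_nonneg ((T x - clip (t * r) (T' x)) - (clip (t * r) (T' x) - ψT x))]
      _ ≤ _ := by
          rw [integral_add i12 i3, integral_add i1 i2, integral_const_mul,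
            integral_const_mul, integral_const_mul]
          linarith
  -- Young's inequality with parameter `η`: `U` is small in mean square relative to `r ^ 2`, while
  -- `D` is only of order `r`.
  have hUD : |∫ x, U x * D x ∂μ| ≤ (2 * η)⁻¹ * ∫ x, U x ^ 2 ∂μ + η / 2 * ∫ x, D x ^ 2 ∂μ := by
    have i1 := (hU.sq.integrable μ).const_mul (2 * η)⁻¹
    have i2 := (hD.sq.integrable μ).const_mul (η / 2)
    rw [← integral_const_mul, ← integral_const_mul, ← integral_add i1 i2]
    refine abs_integral_le_integral_abs.trans
      (integral_mono ((hU.mul hD).abs.integrable μ) (i1.add i2) fun x => ?_)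
    have h1 : (2 * η)⁻¹ * U x ^ 2 + η / 2 * D x ^ 2 - |U x * D x| =
        (2 * η)⁻¹ * (|U x| - η * |D x|) ^ 2 := by
      rw [abs_mul, ← sq_abs (U x), ← sq_abs (D x)]
      field_simp
      ring
    have h2 : 0 ≤ (2 * η)⁻¹ * (|U x| - η * |D x|) ^ 2 := by positivity
    linarith
  have hψD : |∫ x, (ψS x + ψT x) * D x ∂μ| ≤ 4 * (2 * (t * r)) * K * r ^ 2 * e := by
    rw [← hV]
    refine abs_integral_mul_infoSum_sub_le p q hent hφ ha hK (ψ := fun x => ψS x + ψT x) ?_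
      (by positivity) fun x => (abs_add_le _ _).trans ?_
    · intro x y hxy
      have h1 : infoSum p inner x = infoSum p inner y :=
        dependsOn_infoSum p inner fun i hi =>
          hxy i (box_subset_box (by omega) (by omega) hi)
      have h2 := dependsOn_localInfoSum μ φ q m a hxy
      simp only [ψS, ψT, inner, h1, h2]
    · have h1 : |ψS x| ≤ t * r := abs_clip_le htr.le _
      have h2 : |ψT x| ≤ t * r := abs_clip_le htr.le _
      linarith
  have hsplit : r ^ 2 * (σp - σq) = ∫ x, U x * D x ∂μ + ∫ x, (ψS x + ψT x) * D x ∂μ := by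
    rw [mul_sub, ← hS2, ← hT2, ← integral_sub (hS.sq.integrable μ) (hT.sq.integrable μ),
      ← integral_add ((hU.mul hD).integrable μ) ((hψ.mul hD).integrable μ)]
    refine integral_congr_ae (.of_forall fun x => ?_)
    simp only [U, D]
    ring
  have hr2 : 0 < r ^ 2 := by positivity
  refine le_of_mul_le_mul_left ?_ hr2
  calc r ^ 2 * |σp - σq| = |r ^ 2 * (σp - σq)| := by rw [abs_mul, abs_of_pos hr2]
    _ ≤ |∫ x, U x * D x ∂μ| + |∫ x, (ψS x + ψT x) * D x ∂μ| := by
        rw [hsplit]; exact abs_add_le _ _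
    _ ≤ (2 * η)⁻¹ * (2 * (2 * ((r ^ 2 - inner.card) * σp) + 2 * (Cp * Real.exp (-t) * r ^ 2)) +
          4 * (2 * ((r ^ 2 - inner.card) * σq) + 2 * (Cq * Real.exp (-t) * r ^ 2)) +
          4 * (2 * (t * r) * (r ^ 2 * (K * e)))) +
        η / 2 * (2 * (r ^ 2 * σp) + 2 * (r ^ 2 * σq)) + 4 * (2 * (t * r)) * K * r ^ 2 * e := by
        refine add_le_add (hUD.trans (add_le_add ?_ ?_)) hψD
        · exact mul_le_mul_of_nonneg_left hU2 (by positivity)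
        · exact mul_le_mul_of_nonneg_left hD2 (by positivity)
    _ = _ := by
        field_simp
        ring

end Main

/-! ### Limits in `m`, then in the ratio `k`, then in `η`. -/

section Limit

variable {d : ℕ} {A B : Type*} [Fintype A] [MeasurableSpace A] [MeasurableSingletonClass A]
  [Fintype B] [MeasurableSpace B] [MeasurableSingletonClass B]

/-- Equal-entropy finitary factors with `m ^ (d / 2) P(R > m) → 0` preserve information variance. -/
lemma variance_information_eq (p : Measure A) [IsProbabilityMeasure p] (q : Measure B)
    [IsProbabilityMeasure q] {φ : Config d A → Config d B} (hent : entropy p = entropy q)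
    (hφ : IsFactorMap (iidLaw d p) (iidLaw d q) φ)
    (htail : Tendsto (fun m : ℕ => (m : ℝ) ^ ((d : ℝ) / 2) * radiusTail (iidLaw d p) φ m)
      atTop (𝓝 0)) :
    variance (fun x => information p (x 0)) (iidLaw d p) =
      variance (fun y => information q (y 0)) (iidLaw d q) := by
  obtain ⟨K, hK0, hK⟩ := exists_information_le q
  obtain ⟨Cp, -, hCp⟩ := exists_integral_sq_infoSum_sub_clip_le (d := d) p
  obtain ⟨Cq, -, hCq⟩ := exists_integral_sq_infoSum_sub_clip_le (d := d) q
  set σp := variance (fun x => information p (x 0)) (iidLaw d p)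
  set σq := variance (fun y => information q (y 0)) (iidLaw d q)
  -- Take `a = k * m` and `t = k`. Letting `m → ∞` with `k` fixed removes the radius terms; the
  -- condition `2 < k` keeps the inner box, of side `(k - 2) * m`, nonempty.
  have fixed_ratio : ∀ η : ℝ, 0 < η → ∀ k : ℕ, 2 < k →
      |σp - σq| ≤ η⁻¹ * ((2 * σp + 4 * σq) * (1 - (1 - 4 / ((k : ℝ) + 2)) ^ d) +
        (2 * Cp + 4 * Cq) * Real.exp (-(k : ℝ))) + η * (σp + σq) := by
    intro η hη k hk
    have hk' : (2 : ℝ) < k := by exact_mod_cast hk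
    let c : ℝ := ((k : ℝ) + 2) ^ ((d : ℝ) / 2)
    let w : ℕ → ℝ := fun m => c * ((m : ℝ) ^ ((d : ℝ) / 2) * radiusTail (iidLaw d p) φ m)
    have hw : Tendsto w atTop (𝓝 0) := by simpa using htail.const_mul c
    have hlim : Tendsto (fun m => η⁻¹ * ((2 * σp + 4 * σq) * (1 - (1 - 4 / ((k : ℝ) + 2)) ^ d) +
        (2 * Cp + 4 * Cq) * Real.exp (-(k : ℝ)) + 4 * k * K * w m) + η * (σp + σq) +
          8 * k * K * w m) atTop
        (𝓝 (η⁻¹ * ((2 * σp + 4 * σq) * (1 - (1 - 4 / ((k : ℝ) + 2)) ^ d) +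
        (2 * Cp + 4 * Cq) * Real.exp (-(k : ℝ)) + 4 * k * K * 0) + η * (σp + σq) +
          8 * k * K * 0)) :=
      ((((hw.const_mul _).const_add _).const_mul _).add_const _).add (hw.const_mul _)
    simp only [mul_zero, add_zero] at hlim
    refine ge_of_tendsto hlim ((eventually_gt_atTop 0).mono fun m hm => ?_)
    have hm' : (0 : ℝ) < m := by exact_mod_cast hm
    -- The square root of the cell volume, which explains the exponent `d / 2` in the tail
    -- condition.
    let r : ℝ := (((k : ℝ) + 2) * m) ^ ((d : ℝ) / 2)
    have hr : 0 < r := by positivity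
    have hr2 : r ^ 2 = (((k : ℝ) + 2) * m) ^ d := by
      rw [← Real.rpow_natCast r 2, ← Real.rpow_mul (by positivity), ← Real.rpow_natCast _ d]
      congr 1
      push_cast
      ring
    have hV : ((box d (-m) ((k * m : ℕ) + m)).card : ℝ) = r ^ 2 := by
      rw [card_box_real d (by push_cast; nlinarith), hr2]
      push_cast
      ring
    have hinner : ((box d m ((k * m : ℕ) - m)).card : ℝ) / r ^ 2 =
        (1 - 4 / ((k : ℝ) + 2)) ^ d := by
      rw [card_box_real d (by push_cast; nlinarith), hr2, ← div_pow]
      push_cast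
      congr 1
      field_simp
      ring
    have h := abs_variance_sub_le p q hent hφ hK0 hK hCp hCq (m := m) (a := k * m)
      (by positivity) hr (t := k) (by positivity) hη hV
    have hre : r * radiusTail (iidLaw d p) φ m = w m := by
      simp only [r, w, c]
      rw [Real.mul_rpow (by positivity) (by positivity)]
      ring
    rw [hinner, hre] at h
    exact h
  -- As `k → ∞` the inner box fills the cell and the truncation error `exp (-k)` disappears.
  have fixed_eta : ∀ η : ℝ, 0 < η → |σp - σq| ≤ η * (σp + σq) := by
    intro η hη
    have h1 : Tendsto (fun k : ℕ => (1 - 4 / ((k : ℝ) + 2)) ^ d) atTop (𝓝 ((1 - 0) ^ d)) := by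
      refine (tendsto_const_nhds.sub ?_).pow d
      exact tendsto_const_nhds.div_atTop (tendsto_natCast_atTop_atTop.atTop_add tendsto_const_nhds)
    have h2 : Tendsto (fun k : ℕ => Real.exp (-(k : ℝ))) atTop (𝓝 0) :=
      Real.tendsto_exp_neg_atTop_nhds_zero.comp tendsto_natCast_atTop_atTop
    have hlim := ((((h1.const_sub 1).const_mul (2 * σp + 4 * σq)).add
      (h2.const_mul (2 * Cp + 4 * Cq))).const_mul η⁻¹).add_const (η * (σp + σq))
    have hlim' := ge_of_tendsto hlim ((eventually_gt_atTop 2).mono fun k hk => fixed_ratio η hη k hk)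
    simpa using hlim'
  have hlim : Tendsto (fun η : ℝ => η * (σp + σq)) (𝓝[>] 0) (𝓝 (0 * (σp + σq))) :=
    (tendsto_nhdsWithin_of_tendsto_nhds tendsto_id).mul_const _
  have h0 := ge_of_tendsto hlim (eventually_mem_nhdsWithin.mono fun η hη => fixed_eta η hη)
  rw [zero_mul] at h0
  exact sub_eq_zero.1 (abs_nonpos_iff.1 h0)

end Limit

end FinitaryFactor

end

theorem theorem1 {A B : Type*}
    [Fintype A] [MeasurableSpace A] [MeasurableSingletonClass A]
    [Fintype B] [MeasurableSpace B] [MeasurableSingletonClass B]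
    (d : ℕ) (hd : 0 < d)
    (p : Measure A) [IsProbabilityMeasure p] (q : Measure B) [IsProbabilityMeasure q]
    (hent : FinitaryFactor.entropy p = FinitaryFactor.entropy q)
    (φ : FinitaryFactor.Config d A → FinitaryFactor.Config d B)
    (hφ : FinitaryFactor.IsFactorMap (FinitaryFactor.iidLaw d p) (FinitaryFactor.iidLaw d q) φ)
    (hfin : FinitaryFactor.IsFinitary (FinitaryFactor.iidLaw d p) φ)
    (hmom : FinitaryFactor.codingMoment (FinitaryFactor.iidLaw d p) φ ((d : ℝ) / 2) < ⊤) :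
    variance (fun x => FinitaryFactor.information p (x 0)) (FinitaryFactor.iidLaw d p) =
      variance (fun y => FinitaryFactor.information q (y 0)) (FinitaryFactor.iidLaw d q) :=
  FinitaryFactor.variance_information_eq p q hent hφ
    (FinitaryFactor.tendsto_rpow_mul_radiusTail hφ.measurePreserving.measurable hfin
      (by positivity) hmom)
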